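/- **Lemma 4.1 and its Corollary (zero counting via a mollifier).** For a positive integer $A$ put $$U_A(s)=\sum_{n=1}^{A}\frac{\mu(n)}{n^{s}},\qquad V_A(s)=\zeta(s)U_A(s)-1,$$ where $\mu$ is the Möbius function and $\zeta$ the Riemann zeta function. For real $\sigma,T$ let $N(\sigma,T)$ be the number of zeros $\beta+i\gamma$ of $\zeta$, counted with multiplicity, with $\sigma\le\beta$ and $0\le\gamma<T$. With $b_1=5.134$ put $$X_A(T)=\tfrac{16}{9}A^{3/4}\bigl(T+\tfrac74\bigr)^{3/2}+b_1A^{3/4}\bigl(T+\tfrac74\bigr)^{1/2},\qquad c_A(T)=\frac{\log X_A(T)+\log\bigl(X_A(T)+2\bigr)+\log 2}{\log(7/6)}.$$ (a) Let $A\ge16$ be an integer and let $\tfrac12\le\sigma_0<\sigma<1$ and $T\ge14$ be real. Then there are only finitely many zeros $\beta+i\gamma$ of $\zeta$ with $\sigma\le\beta$, $0\le\gamma<T$, and $$N(\sigma,T)\le\frac{1}{\sigma-\sigma_0}\left(\frac{1}{2\pi}\int_{14}^{T}\bigl|V_A(\sigma_0+it)\bigr|^{2}\,dt+\frac{16\,T}{2\pi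 A}+1+c_A(T)\right).$$ (b) Let $A\ge1$ be an integer and $T$ a real number with $A\le\frac{595}{594}T$ and $T\ge\exp(\exp(18))$. Then $$c_A(T)\le 29.193\,\log T+11.978 .$$ -/

import Mathlib

namespace ZeroCounting

noncomputable section

/-- The Möbius-truncated mollifier: the sum of `μ(n) / n ^ s` over `1 ≤ n ≤ A`. -/
def U (A : ℕ) (s : ℂ) : ℂ :=
  ∑ n ∈ Finset.Icc 1 A, ((ArithmeticFunction.moebius n : ℤ) : ℂ) / (n : ℂ) ^ s

/-- `V_A(s) = ζ(s) U_A(s) - 1`. -/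
def V (A : ℕ) (s : ℂ) : ℂ := riemannZeta s * U A s - 1

/-- The zeros `β + iγ` of the Riemann zeta function with `σ ≤ β` and `0 ≤ γ < T`. -/
def zetaZeros (σ T : ℝ) : Set ℂ :=
  {ρ | riemannZeta ρ = 0 ∧ σ ≤ ρ.re ∧ 0 ≤ ρ.im ∧ ρ.im < T}

/-- `N(σ, T)`: the number of zeros `β + iγ` of the Riemann zeta function with `σ ≤ β` and
`0 ≤ γ < T`, each counted with its multiplicity. -/
def zeroCount (σ T : ℝ) : ℕ :=
  ∑ᶠ ρ ∈ zetaZeros σ T, analyticOrderNatAt riemannZeta ρ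

/-- The constant `b₁ = 5.134`. -/
def b₁ : ℝ := 5.134

/-- `(16/9) A^(3/4) (T + 7/4)^(3/2) + b₁ A^(3/4) (T + 7/4)^(1/2)`. -/
def X (A : ℕ) (T : ℝ) : ℝ :=
  16 / 9 * (A : ℝ) ^ (3 / 4 : ℝ) * (T + 7 / 4) ^ (3 / 2 : ℝ) +
    b₁ * (A : ℝ) ^ (3 / 4 : ℝ) * (T + 7 / 4) ^ (1 / 2 : ℝ)

/-- The explicit logarithmic term `c_A(T)`. -/
def c (A : ℕ) (T : ℝ) : ℝ :=
  Real.log (X A T) / Real.log (7 / 6) + Real.log (X A T + 2) / Real.log (7 / 6) +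
    Real.log 2 / Real.log (7 / 6)

end

end ZeroCounting

/-!
The zeros are counted with Littlewood's lemma for `h = 1 - V_A ^ 2 = ζ · U_A · (2 - ζ U_A)`, which
`ζ` divides. For an analytic function on a rectangle, Littlewood's lemma
(`exists_littlewoodIdentity`) expresses `2π` times the sum over the zeros of the distance to the
left edge as the integral of `log ‖h‖` over the left edge, minus that over the right edge, plus the
difference of the integrals of `arg h` over the two horizontal edges. It is multiplicative in `h`,
so it is enough to know it for a linear factor and for the exponential of an analytic function.

On the left edge `log ‖h‖ ≤ ‖V_A‖ ^ 2`, which produces the mean square of `V_A`. The right edge is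
`Re s = 2`, where `‖V_A‖ ≤ 2 / A` (`norm_V_two_le`), so it costs `O(T / A)`. On a horizontal edge
the argument is bounded by Backlund's trick (`integral_abs_arg_le`): each change by `π` forces a
zero of the real part of `h` on the edge, and the *integral* of the argument is then bounded
directly by Jensen's formula on the disc whose radius is the edge. The cost of both edges is
`(3/2) log (X (X + 2))` up to constants, whereas `c_A(T)` allows more than `6 log (X (X + 2))`,
since `log (7/6) < 1/6`; the bound `‖ζ U_A‖ ≤ X_A(T)` follows from
`ζ(s) = s / (s - 1) - s ∫₁^∞ {t} t^(-s-1) dt` (`riemannZeta_eq_of_pos`).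

The room left in `c_A(T)` pays for the zeros with ordinate below `15`. Their weighted count is at
most `27`, by the same argument applied to `(s - 1) ζ(s) / s` (`sum_order_low_zeros_le`), so it is
not needed that `ζ` has no zeros of ordinate below `14`. Edges carrying zeros are avoided: the
horizontal ones can be moved freely in the rectangle between heights `14` and `T`, and the left one
is moved to the right of `Re s = σ₀` and brought back by continuity of the mean square
(`mul_sum_order_high_zeros_le`).

The second part is a comparison of constants: `c_A(T)` is about `(9/2) log T / log (7/6)`, and
`29.193` exceeds `4.5 / log (7/6)` by enough to absorb the bounded terms for such large `T`.
-/

/-! ### Littlewood's lemma on a rectangle -/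

namespace ZeroCounting

open Complex Set MeasureTheory

/-- Littlewood's identity for `h` on the rectangle `[a, c] × [b, d]` with total weight `S`: there is
a continuous determination of the argument of `h` along the bottom, right and top edges, and for it
`2πS` is the left integral of `log ‖h‖` minus the right one, plus the top integral of the argument
minus the bottom one. For `h` analytic, `S` is the sum of the distances of the zeros of `h` to the
left edge. -/
def LittlewoodIdentity (a c b d : ℝ) (h : ℂ → ℂ) (S : ℝ) : Prop :=
  ∃ θt θb θr : ℝ → ℝ,
    ContinuousOn θt (Icc a c) ∧ ContinuousOn θb (Icc a c) ∧ ContinuousOn θr (Icc b d) ∧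
    θt c = θr d ∧ θb c = θr b ∧
    (∀ x ∈ Icc a c, h (x + d * I) = ‖h (x + d * I)‖ * exp (θt x * I)) ∧
    (∀ x ∈ Icc a c, h (x + b * I) = ‖h (x + b * I)‖ * exp (θb x * I)) ∧
    (∀ t ∈ Icc b d, h (c + t * I) = ‖h (c + t * I)‖ * exp (θr t * I)) ∧
    ContinuousOn (fun t : ℝ => h (a + t * I)) (Icc b d) ∧
    ContinuousOn (fun t : ℝ => h (c + t * I)) (Icc b d) ∧
    (∀ t ∈ Icc b d, h (a + t * I) ≠ 0) ∧ (∀ t ∈ Icc b d, h (c + t * I) ≠ 0) ∧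
    2 * Real.pi * S = (∫ t in b..d, Real.log ‖h (a + t * I)‖) -
      (∫ t in b..d, Real.log ‖h (c + t * I)‖) + (∫ x in a..c, θt x) - ∫ x in a..c, θb x

lemma intervalIntegrable_log_norm {b d : ℝ} (hbd : b ≤ d) {f : ℝ → ℂ}
    (hf : ContinuousOn f (Icc b d)) (h0 : ∀ t ∈ Icc b d, f t ≠ 0) :
    IntervalIntegrable (fun t => Real.log ‖f t‖) volume b d := by
  apply ContinuousOn.intervalIntegrable
  rw [uIcc_of_le hbd]
  exact hf.norm.log fun t ht => norm_ne_zero_iff.2 (h0 t ht)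

lemma LittlewoodIdentity.congr {a c b d S : ℝ} (hac : a ≤ c) (hbd : b ≤ d) {h k : ℂ → ℂ}
    (H : LittlewoodIdentity a c b d h S) (hk : ∀ z ∈ Icc a c ×ℂ Icc b d, k z = h z) :
    LittlewoodIdentity a c b d k S := by
  obtain ⟨θt, θb, θr, h1, h2, h3, h4, h5, h6, h7, h8, h9, h10, h11, h12, h13⟩ := H
  have kt : ∀ x ∈ Icc a c, k (x + d * I) = h (x + d * I) := fun x hx =>
    hk _ (by simp [mem_reProdIm, hx.1, hx.2, hbd])
  have kb : ∀ x ∈ Icc a c, k (x + b * I) = h (x + b * I) := fun x hx =>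
    hk _ (by simp [mem_reProdIm, hx.1, hx.2, hbd])
  have kl : ∀ t ∈ Icc b d, k (a + t * I) = h (a + t * I) := fun x hx =>
    hk _ (by simp [mem_reProdIm, hx.1, hx.2, hac])
  have kr : ∀ t ∈ Icc b d, k (c + t * I) = h (c + t * I) := fun x hx =>
    hk _ (by simp [mem_reProdIm, hx.1, hx.2, hac])
  refine ⟨θt, θb, θr, h1, h2, h3, h4, h5, ?_, ?_, ?_, h9.congr kl, h10.congr kr, ?_, ?_, ?_⟩
  · intro x hx; rw [kt x hx]; exact h6 x hx
  · intro x hx; rw [kb x hx]; exact h7 x hx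
  · intro x hx; rw [kr x hx]; exact h8 x hx
  · intro x hx; rw [kl x hx]; exact h11 x hx
  · intro x hx; rw [kr x hx]; exact h12 x hx
  · rw [h13]
    congr 3
    · refine intervalIntegral.integral_congr fun t ht => ?_
      rw [uIcc_of_le hbd] at ht
      simp only [kl t ht]
    · refine intervalIntegral.integral_congr fun t ht => ?_
      rw [uIcc_of_le hbd] at ht
      simp only [kr t ht]

lemma LittlewoodIdentity.mul {a c b d S S' : ℝ} (hac : a ≤ c) (hbd : b ≤ d) {h k : ℂ → ℂ}
    (H : LittlewoodIdentity a c b d h S) (K : LittlewoodIdentity a c b d k S') :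
    LittlewoodIdentity a c b d (fun z => h z * k z) (S + S') := by
  obtain ⟨θt, θb, θr, h1, h2, h3, h4, h5, h6, h7, h8, h9, h10, h11, h12, h13⟩ := H
  obtain ⟨φt, φb, φr, k1, k2, k3, k4, k5, k6, k7, k8, k9, k10, k11, k12, k13⟩ := K
  have polar : ∀ {u v : ℂ} {s t : ℝ}, u = ‖u‖ * exp (s * I) → v = ‖v‖ * exp (t * I) →
      u * v = ‖u * v‖ * exp ((s + t : ℝ) * I) := by
    intro u v s t hu hv
    rw [norm_mul]
    nth_rewrite 1 [hu]
    nth_rewrite 1 [hv]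
    push_cast
    rw [add_mul, exp_add]
    ring
  refine ⟨fun x => θt x + φt x, fun x => θb x + φb x, fun x => θr x + φr x, h1.add k1, h2.add k2,
    h3.add k3, by simp [h4, k4], by simp [h5, k5], fun x hx => polar (h6 x hx) (k6 x hx),
    fun x hx => polar (h7 x hx) (k7 x hx), fun x hx => polar (h8 x hx) (k8 x hx),
    h9.mul k9, h10.mul k10, fun t ht => mul_ne_zero (h11 t ht) (k11 t ht),
    fun t ht => mul_ne_zero (h12 t ht) (k12 t ht), ?_⟩
  have eL : (∫ t in b..d, Real.log ‖h (a + t * I) * k (a + t * I)‖) =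
      (∫ t in b..d, Real.log ‖h (a + t * I)‖) + ∫ t in b..d, Real.log ‖k (a + t * I)‖ := by
    rw [← intervalIntegral.integral_add (intervalIntegrable_log_norm hbd h9 h11)
      (intervalIntegrable_log_norm hbd k9 k11)]
    refine intervalIntegral.integral_congr fun t ht => ?_
    rw [uIcc_of_le hbd] at ht
    simp only [norm_mul]
    rw [Real.log_mul (norm_ne_zero_iff.2 (h11 t ht)) (norm_ne_zero_iff.2 (k11 t ht))]
  have eR : (∫ t in b..d, Real.log ‖h (c + t * I) * k (c + t * I)‖) =
      (∫ t in b..d, Real.log ‖h (c + t * I)‖) + ∫ t in b..d, Real.log ‖k (c + t * I)‖ := by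
    rw [← intervalIntegral.integral_add (intervalIntegrable_log_norm hbd h10 h12)
      (intervalIntegrable_log_norm hbd k10 k12)]
    refine intervalIntegral.integral_congr fun t ht => ?_
    rw [uIcc_of_le hbd] at ht
    simp only [norm_mul]
    rw [Real.log_mul (norm_ne_zero_iff.2 (h12 t ht)) (norm_ne_zero_iff.2 (k12 t ht))]
  have ii : ∀ {f : ℝ → ℝ}, ContinuousOn f (Icc a c) → IntervalIntegrable f volume a c := by
    intro f hf
    apply ContinuousOn.intervalIntegrable
    rwa [uIcc_of_le hac]
  rw [eL, eR, intervalIntegral.integral_add (ii h1) (ii k1),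
    intervalIntegral.integral_add (ii h2) (ii k2), mul_add, h13, k13]
  ring

/-- A function with an analytic logarithm on the rectangle satisfies the identity with weight `0`:
this is the imaginary part of Cauchy's theorem for the logarithm. -/
lemma littlewoodIdentity_exp {a c b d : ℝ} (hac : a ≤ c) (hbd : b ≤ d) {G : ℂ → ℂ}
    (hG : DifferentiableOn ℂ G (Icc a c ×ℂ Icc b d)) :
    LittlewoodIdentity a c b d (fun z => exp (G z)) 0 := by
  have mt : MapsTo (fun x : ℝ => (x + d * I : ℂ)) (Icc a c) (Icc a c ×ℂ Icc b d) := fun x hx => by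
    simp [mem_reProdIm, hx.1, hx.2, hbd]
  have mb : MapsTo (fun x : ℝ => (x + b * I : ℂ)) (Icc a c) (Icc a c ×ℂ Icc b d) := fun x hx => by
    simp [mem_reProdIm, hx.1, hx.2, hbd]
  have ml : MapsTo (fun t : ℝ => (a + t * I : ℂ)) (Icc b d) (Icc a c ×ℂ Icc b d) := fun x hx => by
    simp [mem_reProdIm, hx.1, hx.2, hac]
  have mr : MapsTo (fun t : ℝ => (c + t * I : ℂ)) (Icc b d) (Icc a c ×ℂ Icc b d) := fun x hx => by
    simp [mem_reProdIm, hx.1, hx.2, hac]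
  have ct : ContinuousOn (fun x : ℝ => G (x + d * I)) (Icc a c) :=
    hG.continuousOn.comp (by fun_prop) mt
  have cb : ContinuousOn (fun x : ℝ => G (x + b * I)) (Icc a c) :=
    hG.continuousOn.comp (by fun_prop) mb
  have cl : ContinuousOn (fun t : ℝ => G (a + t * I)) (Icc b d) :=
    hG.continuousOn.comp (by fun_prop) ml
  have cr : ContinuousOn (fun t : ℝ => G (c + t * I)) (Icc b d) :=
    hG.continuousOn.comp (by fun_prop) mr
  have polar : ∀ w : ℂ, exp w = ‖exp w‖ * exp (w.im * I) := by
    intro w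
    rw [norm_exp, ofReal_exp, ← exp_add, re_add_im]
  refine ⟨fun x => (G (x + d * I)).im, fun x => (G (x + b * I)).im, fun t => (G (c + t * I)).im,
    continuous_im.comp_continuousOn ct, continuous_im.comp_continuousOn cb,
    continuous_im.comp_continuousOn cr, rfl, rfl, fun x _ => polar _, fun x _ => polar _,
    fun x _ => polar _, continuous_exp.comp_continuousOn cl, continuous_exp.comp_continuousOn cr,
    fun _ _ => exp_ne_zero _, fun _ _ => exp_ne_zero _, ?_⟩
  have key := integral_boundary_rect_eq_zero_of_differentiableOn G (a + b * I) (c + d * I)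
    (by simpa [uIcc_of_le hac, uIcc_of_le hbd] using hG)
  simp only [add_re, ofReal_re, mul_re, I_re, mul_zero, ofReal_im, I_im, mul_one, sub_self,
    add_zero, add_im, mul_im, zero_add] at key
  have ii : ∀ {f : ℝ → ℂ} {p q : ℝ}, p ≤ q → ContinuousOn f (Icc p q) →
      IntervalIntegrable f volume p q := by
    intro f p q hpq hf
    apply ContinuousOn.intervalIntegrable
    rwa [uIcc_of_le hpq]
  have him : ∀ {f : ℝ → ℂ} {p q : ℝ}, p ≤ q → ContinuousOn f (Icc p q) →
      (∫ x in p..q, (f x).im) = (∫ x in p..q, f x).im := fun hpq hf =>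
    imCLM.intervalIntegral_comp_comm (ii hpq hf)
  have hre : ∀ {f : ℝ → ℂ} {p q : ℝ}, p ≤ q → ContinuousOn f (Icc p q) →
      (∫ x in p..q, (f x).re) = (∫ x in p..q, f x).re := fun hpq hf =>
    reCLM.intervalIntegral_comp_comm (ii hpq hf)
  have := congrArg Complex.im key
  simp only [smul_eq_mul, add_im, sub_im, mul_im, I_re, I_im, zero_mul, one_mul, zero_add,
    zero_im] at this
  simp only [norm_exp, Real.log_exp, mul_zero]
  rw [hre hbd cl, hre hbd cr, him hac ct, him hac cb]
  linarith

lemma littlewoodIdentity_one {a c b d : ℝ} (hac : a ≤ c) (hbd : b ≤ d) :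
    LittlewoodIdentity a c b d (fun _ => 1) 0 := by
  simpa using littlewoodIdentity_exp hac hbd (G := fun _ => 0) (by fun_prop)

lemma hasDerivAt_mul_log_sub {w : ℂ} (hw : w ∈ slitPlane) :
    HasDerivAt (fun w => w * log w - w) (log w) w := by
  have h0 : w ≠ 0 := slitPlane_ne_zero hw
  have := ((hasDerivAt_id w).mul (hasDerivAt_log hw)).sub (hasDerivAt_id w)
  convert! this using 1
  simp [h0]

lemma hasDerivAt_mul_log_neg_sub {w : ℂ} (hw : -w ∈ slitPlane) :
    HasDerivAt (fun w => w * log (-w) - w) (log (-w)) w := by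
  have h0 : w ≠ 0 := neg_ne_zero.1 (slitPlane_ne_zero hw)
  have := ((hasDerivAt_id w).mul ((hasDerivAt_log hw).comp w (hasDerivAt_neg w))).sub
    (hasDerivAt_id w)
  convert! this using 1
  simp [h0]

/-- A linear factor vanishing inside the rectangle. The integrals along the edges come from the
primitive `w log w - w`; on the left edge, which crosses the branch cut of `log w`, the branch
`log (-w)` is used, and the two shifts by `± πi` at the left corners produce the weight. -/
lemma littlewoodIdentity_sub {a c b d : ℝ} {ρ : ℂ} (ha : a < ρ.re) (hc : ρ.re < c)
    (hb : b < ρ.im) (hd : ρ.im < d) :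
    LittlewoodIdentity a c b d (fun z => z - ρ) (ρ.re - a) := by
  have hac : a ≤ c := by linarith
  have hbd : b ≤ d := by linarith
  have st : ∀ x : ℝ, (x + d * I - ρ : ℂ) ∈ slitPlane := fun x => by
    rw [mem_slitPlane_iff]; right; simp; linarith
  have sb : ∀ x : ℝ, (x + b * I - ρ : ℂ) ∈ slitPlane := fun x => by
    rw [mem_slitPlane_iff]; right; simp; linarith
  have sr : ∀ t : ℝ, (c + t * I - ρ : ℂ) ∈ slitPlane := fun x => by
    rw [mem_slitPlane_iff]; left; simp; linarith
  have sl : ∀ t : ℝ, -(a + t * I - ρ : ℂ) ∈ slitPlane := fun x => by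
    rw [mem_slitPlane_iff]; left; simp; linarith
  have ct : Continuous (fun x : ℝ => log (x + d * I - ρ)) :=
    continuous_iff_continuousAt.2 fun x => ContinuousAt.clog (by fun_prop) (st x)
  have cb : Continuous (fun x : ℝ => log (x + b * I - ρ)) :=
    continuous_iff_continuousAt.2 fun x => ContinuousAt.clog (by fun_prop) (sb x)
  have cr : Continuous (fun t : ℝ => log (c + t * I - ρ)) :=
    continuous_iff_continuousAt.2 fun x => ContinuousAt.clog (by fun_prop) (sr x)
  have cl : Continuous (fun t : ℝ => log (-(a + t * I - ρ))) :=
    continuous_iff_continuousAt.2 fun x => ContinuousAt.clog (by fun_prop) (sl x)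
  have polar : ∀ w : ℂ, w = ‖w‖ * exp ((log w).im * I) := fun w => by
    rw [log_im, norm_mul_exp_arg_mul_I]
  refine ⟨fun x => (log (x + d * I - ρ)).im, fun x => (log (x + b * I - ρ)).im,
    fun t => (log (c + t * I - ρ)).im, (continuous_im.comp ct).continuousOn,
    (continuous_im.comp cb).continuousOn, (continuous_im.comp cr).continuousOn, rfl, rfl,
    fun x _ => polar _, fun x _ => polar _, fun x _ => polar _, by fun_prop, by fun_prop,
    fun t _ => neg_ne_zero.1 (slitPlane_ne_zero (sl t)), fun t _ => slitPlane_ne_zero (sr t), ?_⟩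
  have him : ∀ {f : ℝ → ℂ} (p q : ℝ), Continuous f →
      (∫ x in p..q, (f x).im) = (∫ x in p..q, f x).im := fun p q hf =>
    imCLM.intervalIntegral_comp_comm (hf.intervalIntegrable p q)
  have hre : ∀ {f : ℝ → ℂ} (p q : ℝ), Continuous f →
      (∫ x in p..q, (f x).re) = (∫ x in p..q, f x).re := fun p q hf =>
    reCLM.intervalIntegral_comp_comm (hf.intervalIntegrable p q)
  have eL : (∫ t in b..d, Real.log ‖(a + t * I - ρ : ℂ)‖) =
      (∫ t in b..d, log (-(a + t * I - ρ))).re := by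
    rw [← hre b d cl]; simp only [log_re, norm_neg]
  have eR : (∫ t in b..d, Real.log ‖(c + t * I - ρ : ℂ)‖) =
      (∫ t in b..d, log (c + t * I - ρ)).re := by
    rw [← hre b d cr]; simp only [log_re]
  have dx : ∀ (e : ℝ) (x : ℝ), HasDerivAt (fun x : ℝ => (x + e * I - ρ : ℂ)) 1 x := fun e x => by
    simpa using ((ofRealCLM.hasDerivAt (x := x)).add_const (e * I : ℂ)).sub_const ρ
  have dt : ∀ (e : ℝ) (t : ℝ), HasDerivAt (fun t : ℝ => (e + t * I - ρ : ℂ)) I t := fun e t => by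
    simpa using (((ofRealCLM.hasDerivAt (x := t)).mul_const I).const_add (e : ℂ)).sub_const ρ
  have It := intervalIntegral.integral_eq_sub_of_hasDerivAt (a := a) (b := c)
    (f := fun x : ℝ => (x + d * I - ρ) * log (x + d * I - ρ) - (x + d * I - ρ))
    (f' := fun x : ℝ => log (x + d * I - ρ))
    (fun x _ => by simpa using! (hasDerivAt_mul_log_sub (st x)).comp x (dx d x))
    (ct.intervalIntegrable _ _)
  have Ib := intervalIntegral.integral_eq_sub_of_hasDerivAt (a := a) (b := c)
    (f := fun x : ℝ => (x + b * I - ρ) * log (x + b * I - ρ) - (x + b * I - ρ))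
    (f' := fun x : ℝ => log (x + b * I - ρ))
    (fun x _ => by simpa using! (hasDerivAt_mul_log_sub (sb x)).comp x (dx b x))
    (cb.intervalIntegrable _ _)
  have Ir := intervalIntegral.integral_eq_sub_of_hasDerivAt (a := b) (b := d)
    (f := fun t : ℝ => (c + t * I - ρ) * log (c + t * I - ρ) - (c + t * I - ρ))
    (f' := fun t : ℝ => log (c + t * I - ρ) * I)
    (fun x _ => by simpa using! (hasDerivAt_mul_log_sub (sr x)).comp x (dt c x))
    ((cr.mul continuous_const).intervalIntegrable _ _)
  have Il := intervalIntegral.integral_eq_sub_of_hasDerivAt (a := b) (b := d)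
    (f := fun t : ℝ => (a + t * I - ρ) * log (-(a + t * I - ρ)) - (a + t * I - ρ))
    (f' := fun t : ℝ => log (-(a + t * I - ρ)) * I)
    (fun x _ => HasDerivAt.comp (h₂ := fun w : ℂ => w * log (-w) - w) x
      (hasDerivAt_mul_log_neg_sub (sl x)) (dt a x))
    ((cl.mul continuous_const).intervalIntegrable _ _)
  rw [intervalIntegral.integral_mul_const] at Ir Il
  -- the logarithms at the two left corners
  have ltl : log (-(a + d * I - ρ)) = log (a + d * I - ρ) - Real.pi * I := by
    apply Complex.ext
    · simp [log_re, norm_sub_rev]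
    · rw [log_im, sub_im, log_im, arg_neg_eq_arg_sub_pi_of_im_pos (by simp; linarith)]
      simp
  have lbl : log (-(a + b * I - ρ)) = log (a + b * I - ρ) + Real.pi * I := by
    apply Complex.ext
    · simp [log_re, norm_sub_rev]
    · rw [log_im, add_im, log_im, arg_neg_eq_arg_add_pi_of_im_neg (by simp; linarith)]
      simp
  rw [ltl, lbl] at Il
  rw [eL, eR, him a c ct, him a c cb]
  have hsum : (∫ t in b..d, log (-(a + t * I - ρ))) * I - (∫ t in b..d, log (c + t * I - ρ)) * I +
      (∫ x in a..c, log (x + d * I - ρ)) - (∫ x in a..c, log (x + b * I - ρ)) =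
      - (Real.pi * I) * ((a + d * I - ρ) + (a + b * I - ρ)) := by
    rw [Il, Ir, It, Ib]; ring
  have := congrArg Complex.im hsum
  simp [-neg_sub] at this
  linarith

end ZeroCounting

/-! ### Littlewood's lemma for analytic functions -/

namespace ZeroCounting

open Complex Set MeasureTheory Filter Topology

lemma LittlewoodIdentity.pow {a c b d S : ℝ} (hac : a ≤ c) (hbd : b ≤ d) {h : ℂ → ℂ}
    (H : LittlewoodIdentity a c b d h S) (n : ℕ) :
    LittlewoodIdentity a c b d (fun z => h z ^ n) (n * S) := by
  induction n with
  | zero => simpa using littlewoodIdentity_one hac hbd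
  | succ n ih =>
    have := ih.mul hac hbd H
    simp only [pow_succ]
    convert! this using 1
    push_cast; ring

lemma LittlewoodIdentity.prod {ι : Type*} {a c b d : ℝ} (hac : a ≤ c) (hbd : b ≤ d)
    (s : Finset ι) (h : ι → ℂ → ℂ) (S : ι → ℝ)
    (H : ∀ i ∈ s, LittlewoodIdentity a c b d (h i) (S i)) :
    LittlewoodIdentity a c b d (fun z => ∏ i ∈ s, h i z) (∑ i ∈ s, S i) := by
  classical
  induction s using Finset.induction_on with
  | empty => simpa using littlewoodIdentity_one hac hbd
  | insert i s hi ih =>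
    simp only [Finset.prod_insert hi, Finset.sum_insert hi]
    exact (H i (by simp)).mul hac hbd (ih fun j hj => H j (by simp [hj]))

/-- A zero-free analytic function on a convex open set has an analytic logarithm. -/
lemma exists_differentiableOn_log {W : Set ℂ} (hW : Convex ℝ W) (hWo : IsOpen W)
    (hne : W.Nonempty) {g : ℂ → ℂ} (hg : DifferentiableOn ℂ g W) (h0 : ∀ z ∈ W, g z ≠ 0) :
    ∃ G : ℂ → ℂ, DifferentiableOn ℂ G W ∧ ∀ z ∈ W, exp (G z) = g z := by
  have hsc : IsSimplyConnected W := by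
    have := hW.contractibleSpace hne
    exact (inferInstance : SimplyConnectedSpace W)
  obtain ⟨G, hGc, hG⟩ := exists_continuousOn_eqOn_exp_comp hsc hWo hg.continuousOn
    (by rintro ⟨z, hz, hz0⟩; exact h0 z hz hz0)
  refine ⟨G, fun z hz => ?_, hG⟩
  have hGz : ContinuousAt G z := hGc.continuousAt (hWo.mem_nhds hz)
  -- near `z`, the continuous branch is `G z + log (g / g z)`
  have him : ∀ᶠ w in 𝓝 z, |(G w - G z).im| < Real.pi := by
    have : ContinuousAt (fun w => |(G w - G z).im|) z :=
      (continuous_im.continuousAt.comp (hGz.sub continuousAt_const)).abs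
    exact this.eventually_lt continuousAt_const (by simpa using Real.pi_pos)
  have heq : G =ᶠ[𝓝 z] fun w => G z + log (g w / g z) := by
    filter_upwards [him, hWo.mem_nhds hz] with w hw hwW
    rw [← hG hwW, ← hG hz]
    simp only [Function.comp_apply]
    rw [← exp_sub, log_exp (by linarith [(abs_lt.1 hw).1]) (abs_lt.1 hw).2.le]
    ring
  have hd : DifferentiableAt ℂ (fun w => G z + log (g w / g z)) z := by
    have hgz : DifferentiableAt ℂ g z := hg.differentiableAt (hWo.mem_nhds hz)
    refine (DifferentiableAt.clog (hgz.div_const _) ?_).const_add _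
    rw [div_self (h0 z hz)]
    exact one_mem_slitPlane
  exact (hd.congr_of_eventuallyEq heq).differentiableWithinAt

lemma convex_Icc_reProdIm_Icc (a c b d : ℝ) : Convex ℝ (Icc a c ×ℂ Icc b d) :=
  ((convex_Icc a c).linear_preimage reLm).inter ((convex_Icc b d).linear_preimage imLm)

lemma littlewoodIdentity_of_ne_zero {a c b d : ℝ} (hac : a ≤ c) (hbd : b ≤ d) {g : ℂ → ℂ}
    (hg : AnalyticOnNhd ℂ g (Icc a c ×ℂ Icc b d)) (h0 : ∀ z ∈ Icc a c ×ℂ Icc b d, g z ≠ 0) :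
    LittlewoodIdentity a c b d g 0 := by
  have hQc : IsCompact (Icc a c ×ℂ Icc b d) := isCompact_Icc.reProdIm isCompact_Icc
  have hQ : Convex ℝ (Icc a c ×ℂ Icc b d) := convex_Icc_reProdIm_Icc a c b d
  have hne : (Icc a c ×ℂ Icc b d).Nonempty := ⟨a + b * I, by simp [mem_reProdIm, hac, hbd]⟩
  have hO : IsOpen ({z | AnalyticAt ℂ g z} ∩ {z | AnalyticAt ℂ g z ∧ g z ≠ 0}) := by
    have h1 : IsOpen {z | AnalyticAt ℂ g z} := isOpen_analyticAt ℂ g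
    have h2 : ContinuousOn g {z | AnalyticAt ℂ g z} :=
      fun z hz => hz.continuousAt.continuousWithinAt
    have := h2.isOpen_inter_preimage h1 (isOpen_compl_singleton (x := (0 : ℂ)))
    convert this using 1
    ext z; simp
  obtain ⟨δ, hδ, hsub⟩ := hQc.exists_thickening_subset_open hO
    (fun z hz => ⟨hg z hz, hg z hz, h0 z hz⟩)
  obtain ⟨G, hG, hGe⟩ := exists_differentiableOn_log (hQ.thickening δ) Metric.isOpen_thickening
    (hne.mono (Metric.self_subset_thickening hδ _))
    (fun z hz => (hsub hz).1.differentiableAt.differentiableWithinAt) (fun z hz => (hsub hz).2.2)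
  exact (littlewoodIdentity_exp hac hbd
    (hG.mono (Metric.self_subset_thickening hδ _))).congr hac hbd
    fun z hz => (hGe z (Metric.self_subset_thickening hδ _ hz)).symm

/-- **Littlewood's lemma**: an analytic function without zeros on the boundary of a rectangle
satisfies Littlewood's identity, the weight being the sum over its zeros, with multiplicity, of the
distance to the left edge. -/
theorem exists_littlewoodIdentity {a c b d : ℝ} (hac : a < c) (hbd : b < d) {h : ℂ → ℂ}
    (hh : AnalyticOnNhd ℂ h (Icc a c ×ℂ Icc b d))
    (h0 : ∀ z ∈ Icc a c ×ℂ Icc b d, h z = 0 → z ∈ Ioo a c ×ℂ Ioo b d) :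
    ∃ Z : Finset ℂ, (∀ z ∈ Icc a c ×ℂ Icc b d, h z = 0 → z ∈ Z) ∧
      (∀ z ∈ Z, z ∈ Ioo a c ×ℂ Ioo b d) ∧
      LittlewoodIdentity a c b d h (∑ z ∈ Z, analyticOrderNatAt h z * (z.re - a)) := by
  set Q : Set ℂ := Icc a c ×ℂ Icc b d with hQdef
  have hQc : IsCompact Q := isCompact_Icc.reProdIm isCompact_Icc
  have hQ : IsPreconnected Q := (convex_Icc_reProdIm_Icc a c b d).isPreconnected
  have hp : (a + b * I : ℂ) ∈ Q := by simp [hQdef, mem_reProdIm, hac.le, hbd.le]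
  have hq : (c + b * I : ℂ) ∈ Q := by simp [hQdef, mem_reProdIm, hac.le, hbd.le]
  have hpq : (a + b * I : ℂ) ≠ c + b * I := fun e => hac.ne (by simpa using congrArg re e)
  have hp0 : h (a + b * I) ≠ 0 := fun e => by
    have := h0 _ hp e
    simp [mem_reProdIm] at this
  have hord : ∀ u : Q, meromorphicOrderAt h u ≠ ⊤ := by
    rw [← hh.meromorphicOn.exists_meromorphicOrderAt_ne_top_iff_forall ⟨⟨_, hp⟩, hQ⟩]
    refine ⟨⟨_, hp⟩, ?_⟩
    rw [(hh _ hp).meromorphicOrderAt_eq, (hh _ hp).analyticOrderAt_eq_zero.2 hp0]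
    simp
  set D := MeromorphicOn.divisor h Q with hD
  have hfin : D.support.Finite := D.finiteSupport hQc
  have hDz : ∀ z ∈ Q, D z = (analyticOrderNatAt h z : ℤ) := by
    intro z hz
    have h1 := hord ⟨z, hz⟩
    rw [(hh z hz).meromorphicOrderAt_eq] at h1
    rw [hD, MeromorphicOn.AnalyticOnNhd.divisor_apply hh hz, analyticOrderNatAt]
    cases e : analyticOrderAt h z with
    | top => simp [e] at h1
    | coe n => simp
  have hDnn : ∀ z, 0 ≤ D z := fun z => MeromorphicOn.AnalyticOnNhd.divisor_nonneg hh z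
  have hsupp : ∀ z, D z ≠ 0 ↔ z ∈ Q ∧ h z = 0 := by
    intro z
    constructor
    · intro hz
      have hzQ : z ∈ Q := D.supportWithinDomain hz
      refine ⟨hzQ, ?_⟩
      by_contra hne
      apply hz
      rw [hDz z hzQ, analyticOrderNatAt, (hh z hzQ).analyticOrderAt_eq_zero.2 hne]
      simp
    · rintro ⟨hzQ, hz⟩ h1
      have h2 := hord ⟨z, hzQ⟩
      rw [hD, hh.meromorphicOn.divisor_apply hzQ, WithTop.untop₀_eq_zero] at h1
      have h3 := h1.resolve_right h2
      rw [(hh z hzQ).meromorphicOrderAt_eq] at h3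
      have h4 : analyticOrderAt h z ≠ 0 := (hh z hzQ).analyticOrderAt_ne_zero.2 hz
      cases e : analyticOrderAt h z with
      | top => simp [e] at h3
      | coe n => simp [e] at h3 h4; exact h4 h3
  obtain ⟨g, hg, hg0, heq⟩ := hh.meromorphicOn.extract_zeros_poles hord hfin
  set Z := hfin.toFinset with hZ
  have hZmem : ∀ z, z ∈ Z ↔ z ∈ Q ∧ h z = 0 := fun z => by
    rw [hZ, Finite.mem_toFinset]; exact hsupp z
  have hφ : ∀ z, (∏ᶠ u, (· - u) ^ D u : ℂ → ℂ) z = ∏ u ∈ Z, (z - u) ^ analyticOrderNatAt h u := by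
    intro z
    rw [finprod_eq_prod_of_mulSupport_subset (s := Z) _
      (by rw [Function.FactorizedRational.mulSupport, hZ]; simp), Finset.prod_apply]
    refine Finset.prod_congr rfl fun u hu => ?_
    rw [Pi.pow_apply, hDz u ((hZmem u).1 hu).1, zpow_natCast]
  have hEq : ∀ z ∈ Q, h z = (∏ u ∈ Z, (z - u) ^ analyticOrderNatAt h u) * g z := by
    intro z hz
    have han : AnalyticAt ℂ (fun z => (∏ u ∈ Z, (z - u) ^ analyticOrderNatAt h u) * g z) z := by
      refine AnalyticAt.mul ?_ (hg z hz)
      fun_prop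
    have hfun : (∏ᶠ u, (· - u) ^ D u : ℂ → ℂ) • g =
        fun z => (∏ u ∈ Z, (z - u) ^ analyticOrderNatAt h u) * g z := by
      funext w
      rw [Pi.smul_apply', hφ, smul_eq_mul]
    rw [hfun] at heq
    have hacc : AccPt z (𝓟 Q) :=
      hQ.preperfect_of_nontrivial ⟨_, hp, _, hq, hpq⟩ z hz
    have h1 := (hh z hz).meromorphicAt.eventuallyEq_nhdsNE_of_eventuallyEq_codiscreteWithin
      han.meromorphicAt hz hacc heq
    exact ((hh z hz).continuousAt.eventuallyEq_nhds_iff_eventuallyEq_nhdsNE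
      han.continuousAt |>.1 h1).eq_of_nhds
  refine ⟨Z, fun z hz hz0 => (hZmem z).2 ⟨hz, hz0⟩, fun z hz => ?_, ?_⟩
  · exact h0 z ((hZmem z).1 hz).1 ((hZmem z).1 hz).2
  have hprod : LittlewoodIdentity a c b d (fun z => ∏ u ∈ Z, (z - u) ^ analyticOrderNatAt h u)
      (∑ z ∈ Z, analyticOrderNatAt h z * (z.re - a)) := by
    refine LittlewoodIdentity.prod hac.le hbd.le Z
      (fun u z => (z - u) ^ analyticOrderNatAt h u) _ fun u hu => ?_
    have := h0 u ((hZmem u).1 hu).1 ((hZmem u).1 hu).2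
    rw [mem_reProdIm] at this
    exact (littlewoodIdentity_sub this.1.1 this.1.2 this.2.1 this.2.2).pow hac.le hbd.le _
  have := hprod.mul hac.le hbd.le
    (littlewoodIdentity_of_ne_zero hac.le hbd.le hg fun z hz => hg0 ⟨z, hz⟩)
  rw [add_zero] at this
  exact this.congr hac.le hbd.le hEq

end ZeroCounting

/-! ### Bounding the variation of the argument along a horizontal edge -/

namespace ZeroCounting

open Complex Set MeasureTheory Filter Topology Metric ComplexConjugate

/-- Jensen's inequality with the distances of the zeros to the centre kept. -/
lemma sum_log_div_dist_le {c : ℂ} {R M : ℝ} (hR : 0 < R) (hM : 1 ≤ M) {f : ℂ → ℂ}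
    (hf : AnalyticOnNhd ℂ f (closedBall c R)) (hfc : f c ≠ 0)
    (hb : ∀ z ∈ closedBall c R, ‖f z‖ ≤ M) (s : Finset ℂ)
    (hs : ∀ u ∈ s, u ∈ closedBall c R ∧ f u = 0) :
    ∑ u ∈ s, Real.log (R / ‖c - u‖) ≤ Real.log M - Real.log ‖f c‖ := by
  have hab : |R| = R := abs_of_pos hR
  rw [← hab] at hf
  have jensen := hf.circleAverage_log_norm hR.ne' hfc
  have hav : Real.circleAverage (fun x ↦ Real.log ‖f x‖) c R ≤ Real.log M := by
    apply Real.circleAverage_mono_on_of_le_circle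
    · exact (hf.mono sphere_subset_closedBall).meromorphicOn.circleIntegrable_log_norm
    · intro z hz
      obtain (h | h) := eq_zero_or_norm_pos (f z)
      · simpa [h] using Real.log_nonneg hM
      · exact Real.log_le_log h (hb z (by rw [← hab]; exact sphere_subset_closedBall hz))
  set D := MeromorphicOn.divisor f (closedBall c |R|) with hD
  have hfin : D.support.Finite := D.finiteSupport (isCompact_closedBall c |R|)
  have hDnn : ∀ z, 0 ≤ D z := fun z => MeromorphicOn.AnalyticOnNhd.divisor_nonneg hf z
  have hord : ∀ u : closedBall c |R|, meromorphicOrderAt f u ≠ ⊤ := by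
    have hcm : c ∈ closedBall c |R| := by simp
    rw [← hf.meromorphicOn.exists_meromorphicOrderAt_ne_top_iff_forall
      ⟨⟨c, hcm⟩, (convex_closedBall c |R|).isPreconnected⟩]
    refine ⟨⟨c, hcm⟩, ?_⟩
    rw [(hf c hcm).meromorphicOrderAt_eq, (hf c hcm).analyticOrderAt_eq_zero.2 hfc]
    simp
  have hDs : ∀ u ∈ s, 1 ≤ D u := by
    intro u hu
    obtain ⟨huB, hu0⟩ := hs u hu
    rw [← hab] at huB
    have h2 := hord ⟨u, huB⟩
    rw [(hf u huB).meromorphicOrderAt_eq] at h2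
    have h4 : analyticOrderAt f u ≠ 0 := (hf u huB).analyticOrderAt_ne_zero.2 hu0
    rw [hD, MeromorphicOn.AnalyticOnNhd.divisor_apply hf huB]
    cases e : analyticOrderAt f u with
    | top => simp [e] at h2
    | coe n =>
      rw [e] at h4
      have : n ≠ 0 := by simpa using h4
      simp only [ENat.map_natCast, WithTop.untop₀_coe]
      omega
  have hterm : ∀ u ∈ closedBall c |R|, u ≠ c → 0 ≤ Real.log (R * ‖c - u‖⁻¹) := by
    intro u hu huc
    apply Real.log_nonneg
    have h1 : 0 < ‖c - u‖ := norm_pos_iff.2 (sub_ne_zero.2 huc.symm)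
    rw [← div_eq_mul_inv, one_le_div h1, ← dist_eq_norm, dist_comm]
    rwa [hab] at hu
  have hfs : ∑ᶠ u, (D u : ℝ) * Real.log (R * ‖c - u‖⁻¹) =
      ∑ u ∈ hfin.toFinset, (D u : ℝ) * Real.log (R * ‖c - u‖⁻¹) := by
    apply finsum_eq_sum_of_support_subset
    intro u hu
    simp only [Function.mem_support, ne_eq, mul_eq_zero, not_or, Int.cast_eq_zero] at hu
    simp only [Finite.coe_toFinset, Function.mem_support]
    exact hu.1
  have hDc : D c = 0 := by
    have hcm : c ∈ closedBall c |R| := by simp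
    rw [hD, MeromorphicOn.AnalyticOnNhd.divisor_apply hf hcm,
      (hf c hcm).analyticOrderAt_eq_zero.2 hfc]
    simp
  have hsub : s ⊆ hfin.toFinset := by
    intro u hu
    rw [Finite.mem_toFinset, Function.mem_support]
    have := hDs u hu
    omega
  have hnn : ∀ u ∈ hfin.toFinset, 0 ≤ (D u : ℝ) * Real.log (R * ‖c - u‖⁻¹) := by
    intro u hu
    rw [Finite.mem_toFinset] at hu
    refine mul_nonneg (by exact_mod_cast hDnn u) (hterm u (D.supportWithinDomain hu) ?_)
    rintro rfl
    exact hu hDc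
  have hle : ∑ u ∈ s, Real.log (R / ‖c - u‖) ≤
      ∑ u ∈ hfin.toFinset, (D u : ℝ) * Real.log (R * ‖c - u‖⁻¹) := by
    refine le_trans (Finset.sum_le_sum fun u hu => ?_)
      (Finset.sum_le_sum_of_subset_of_nonneg hsub fun u hu _ => hnn u hu)
    have huc : u ≠ c := by
      rintro rfl
      exact hfc (hs u hu).2
    have h1 := hterm u (by rw [hab]; exact (hs u hu).1) huc
    have h2 : (1 : ℝ) ≤ D u := by exact_mod_cast hDs u hu
    rw [div_eq_mul_inv]
    nlinarith
  rw [hfs] at jensen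
  linarith

/-- The real part of `h` on the horizontal line of height `T`, continued to an analytic function of
a complex variable. -/
noncomputable def lineRe (h : ℂ → ℂ) (T : ℝ) (z : ℂ) : ℂ :=
  (h (z + T * I) + conj (h (conj z + T * I))) / 2

lemma lineRe_ofReal (h : ℂ → ℂ) (T x : ℝ) : lineRe h T x = ((h (x + T * I)).re : ℂ) := by
  rw [lineRe, conj_ofReal, add_conj]; push_cast; ring

lemma analyticOnNhd_lineRe {h : ℂ → ℂ} {c T R : ℝ}
    (hh : AnalyticOnNhd ℂ h (closedBall (c + T * I) R)) :
    AnalyticOnNhd ℂ (lineRe h T) (closedBall (c : ℂ) R) := by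
  have hsh : ∀ z ∈ closedBall (c : ℂ) R, AnalyticAt ℂ (fun w => h (w + T * I)) z := by
    intro z hz
    refine AnalyticAt.fun_comp (g := h) (hh _ ?_) (by fun_prop)
    simpa [dist_eq_norm] using hz
  intro z hz
  have hz' : conj z ∈ closedBall (c : ℂ) R := by
    rw [mem_closedBall, dist_eq_norm] at hz ⊢
    rw [← conj_ofReal, ← map_sub, norm_conj]
    exact hz
  have h2 : AnalyticAt ℂ (fun w => conj (h (conj w + T * I))) z := by
    have h3 := analyticAt_iff_eventually_differentiableAt.1 (hsh _ hz')
    rw [analyticAt_iff_eventually_differentiableAt]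
    have h4 := (continuous_conj.continuousAt (x := z)).eventually h3
    filter_upwards [h4] with w hw
    have := hw.conj_conj
    simpa [Function.comp_def] using this
  have := ((hsh z hz).add h2).div_const (c := (2 : ℂ))
  exact this

lemma le_add_sum_indicator (n : ℕ) (y : ℝ) (hy : y < Real.pi / 2 + n * Real.pi) :
    y ≤ Real.pi / 2 + ∑ j ∈ Finset.range n, if Real.pi / 2 + j * Real.pi ≤ y then Real.pi else 0 := by
  induction n with
  | zero => simpa using hy.le
  | succ n ih =>
    have hsum : 0 ≤ ∑ j ∈ Finset.range n, if Real.pi / 2 + j * Real.pi ≤ y then Real.pi else 0 :=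
      Finset.sum_nonneg fun j _ => by split_ifs <;> positivity
    rw [Finset.sum_range_succ]
    by_cases hn : Real.pi / 2 + n * Real.pi ≤ y
    · have h1 : ∑ j ∈ Finset.range n, (if Real.pi / 2 + j * Real.pi ≤ y then Real.pi else 0) =
          n * Real.pi := by
        rw [Finset.sum_congr rfl (g := fun _ => Real.pi)]
        · simp
        · intro j hj
          have : (j : ℝ) ≤ n := by exact_mod_cast (Finset.mem_range.1 hj).le
          rw [if_pos]
          nlinarith [Real.pi_pos]
      rw [h1, if_pos hn]
      push_cast at hy
      linarith
    · rw [if_neg hn]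
      have := ih (not_le.1 hn)
      linarith

/-- **Backlund's trick**, integrated: a continuous argument `θ` of `h` along the radius
`[c - R, c] + iT`, near `2πk` at `c + iT`, deviates from `2πk` in mean by a quantity controlled by
Jensen's formula. Each time the deviation passes an odd multiple of `π / 2` the real part of `h`
vanishes; the length `R - r` of the segment where that multiple counts is at most `R log (R / r)`,
which is the contribution of the zero to Jensen's formula. -/
theorem integral_abs_arg_le {h : ℂ → ℂ} {c T R M m : ℝ} (hR : 0 < R) (hM : 1 ≤ M) (hm : 0 < m)
    (hh : AnalyticOnNhd ℂ h (closedBall (c + T * I) R))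
    (hb : ∀ z ∈ closedBall (c + T * I : ℂ) R, ‖h z‖ ≤ M) (hc : m ≤ (h (c + T * I)).re)
    {θ : ℝ → ℝ} (hθ : ContinuousOn θ (Icc (c - R) c))
    (hpol : ∀ x ∈ Icc (c - R) c, h (x + T * I) = ‖h (x + T * I)‖ * exp (θ x * I))
    {k : ℤ} (hk : |θ c - 2 * Real.pi * k| < Real.pi / 2) :
    ∫ x in (c - R)..c, |θ x - 2 * Real.pi * k| ≤
      Real.pi * R * (Real.log M - Real.log m) + Real.pi / 2 * R := by
  have hac : c - R ≤ c := by linarith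
  set φ : ℝ → ℝ := fun x => |θ x - 2 * Real.pi * k| with hφ
  have hφc : ContinuousOn φ (Icc (c - R) c) := (hθ.sub continuousOn_const).abs
  -- the real part of `h` vanishes where `φ` is an odd multiple of `π / 2`
  have hzero : ∀ x ∈ Icc (c - R) c, ∀ j : ℕ, φ x = Real.pi / 2 + j * Real.pi →
      lineRe h T x = 0 := by
    intro x hx j hj
    have hcos : Real.cos (θ x) = 0 := by
      have h1 : Real.cos (θ x) = Real.cos (φ x) := by
        rw [hφ, Real.cos_abs, ← Real.cos_sub_int_mul_two_pi (θ x) k]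
        congr 1; ring
      rw [h1, hj, Real.cos_add_nat_mul_pi, Real.cos_pi_div_two, mul_zero]
    rw [lineRe_ofReal, hpol x hx]
    rw [re_ofReal_mul, exp_ofReal_mul_I_re, hcos]
    simp
  obtain ⟨B, hB⟩ := (isCompact_Icc.image_of_continuousOn hφc).bddAbove
  obtain ⟨n, hn⟩ := exists_nat_gt (B / Real.pi)
  have hBn : ∀ x ∈ Icc (c - R) c, φ x < Real.pi / 2 + n * Real.pi := by
    intro x hx
    have h1 : φ x ≤ B := hB ⟨x, hx, rfl⟩
    rw [div_lt_iff₀ Real.pi_pos] at hn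
    linarith [Real.pi_pos]
  classical
  let J : Finset ℕ := (Finset.range n).filter
    fun j => ∃ x ∈ Icc (c - R) c, φ x = Real.pi / 2 + j * Real.pi
  have hy : ∀ j : ℕ, ∃ y, j ∈ J → (y ∈ Icc (c - R) c ∧ φ y = Real.pi / 2 + j * Real.pi ∧
      ∀ x ∈ Icc (c - R) c, φ x = Real.pi / 2 + j * Real.pi → x ≤ y) := by
    intro j
    by_cases hj : j ∈ J
    · obtain ⟨x, hx, hxj⟩ := (Finset.mem_filter.1 hj).2
      have hcomp : IsCompact (Icc (c - R) c ∩ φ ⁻¹' {Real.pi / 2 + j * Real.pi}) :=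
        isCompact_Icc.of_isClosed_subset
          (hφc.preimage_isClosed_of_isClosed isClosed_Icc isClosed_singleton) inter_subset_left
      obtain ⟨y, hy, hymax⟩ := hcomp.exists_isGreatest ⟨x, hx, hxj⟩
      exact ⟨y, fun _ => ⟨hy.1, hy.2, fun x hx hxj => hymax ⟨hx, hxj⟩⟩⟩
    · exact ⟨0, fun h => absurd h hj⟩
  choose y hy using hy
  have hcφ : φ c < Real.pi / 2 := hk
  have hpt : ∀ x ∈ Icc (c - R) c,
      φ x ≤ Real.pi / 2 + ∑ j ∈ J, indicator {x | x ≤ y j} (fun _ => Real.pi) x := by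
    intro x hx
    refine (le_add_sum_indicator n (φ x) (hBn x hx)).trans ?_
    rw [Finset.sum_filter]
    refine add_le_add le_rfl (Finset.sum_le_sum fun j hj => ?_)
    by_cases hxj : Real.pi / 2 + j * Real.pi ≤ φ x
    · have hcon : ContinuousOn φ (Icc x c) := hφc.mono (Icc_subset_Icc_left hx.1)
      have hle : φ c ≤ Real.pi / 2 + j * Real.pi := by
        have : 0 ≤ (j : ℝ) * Real.pi := by positivity
        linarith
      obtain ⟨x', hx', hx'e⟩ := intermediate_value_Icc' hx.2 hcon ⟨hle, hxj⟩
      have hx'm : x' ∈ Icc (c - R) c := ⟨hx.1.trans hx'.1, hx'.2⟩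
      have hjJ : j ∈ J := Finset.mem_filter.2 ⟨hj, x', hx'm, hx'e⟩
      have hxy : x ≤ y j := hx'.1.trans ((hy j hjJ).2.2 x' hx'm hx'e)
      rw [if_pos hxj, if_pos (Finset.mem_filter.1 hjJ).2, indicator_of_mem (by exact hxy)]
    · rw [if_neg hxj]
      split_ifs
      · exact indicator_nonneg (fun _ _ => Real.pi_pos.le) _
      · exact le_rfl
  have hint : ∀ j ∈ J, ∫ x in (c - R)..c, indicator {x | x ≤ y j} (fun _ => Real.pi) x =
      Real.pi * (y j - (c - R)) := by
    intro j hj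
    rw [intervalIntegral.integral_indicator (hy j hj).1]
    simp; ring
  have hII : ∀ j, IntervalIntegrable (indicator {x | x ≤ y j} (fun _ => Real.pi)) volume
      (c - R) c := by
    intro j
    rw [intervalIntegrable_iff]
    exact (integrableOn_const (by simp)).indicator measurableSet_Iic
  have hIIs : IntervalIntegrable
      (fun x => ∑ j ∈ J, indicator {x | x ≤ y j} (fun _ => Real.pi) x) volume (c - R) c := by
    have := IntervalIntegrable.sum (μ := volume) J (f := fun j =>
      indicator {x | x ≤ y j} (fun _ => Real.pi)) fun j _ => hII j
    convert! this using 1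
    ext x; simp
  have h1 : ∫ x in (c - R)..c, φ x ≤ Real.pi / 2 * R + ∑ j ∈ J, Real.pi * (y j - (c - R)) := by
    calc ∫ x in (c - R)..c, φ x
        ≤ ∫ x in (c - R)..c,
          (Real.pi / 2 + ∑ j ∈ J, indicator {x | x ≤ y j} (fun _ => Real.pi) x) := by
          refine intervalIntegral.integral_mono_on hac ?_
            (intervalIntegrable_const.add hIIs) hpt
          apply ContinuousOn.intervalIntegrable
          rwa [uIcc_of_le hac]
      _ = _ := by
          rw [intervalIntegral.integral_add (by simp) hIIs,
            intervalIntegral.integral_finsetSum fun j _ => hII j, Finset.sum_congr rfl hint]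
          simp; ring
  -- Jensen's inequality for the zeros `y j`
  have hymem : ∀ j ∈ J, y j < c := by
    intro j hj
    refine lt_of_le_of_ne (hy j hj).1.2 fun e => ?_
    have := (hy j hj).2.1
    rw [e] at this
    have h2 : 0 ≤ (j : ℝ) * Real.pi := by positivity
    linarith
  have hinj : Set.InjOn (fun j => (y j : ℂ)) J := by
    intro i hi j hj hij
    have e : y i = y j := ofReal_injective hij
    have h1 := (hy i hi).2.1
    rw [e, (hy j hj).2.1] at h1
    have h2 : (j : ℝ) * Real.pi = i * Real.pi := by linarith
    exact_mod_cast (mul_right_cancel₀ Real.pi_ne_zero h2).symm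
  have hcre : lineRe h T c = ((h (c + T * I)).re : ℂ) := lineRe_ofReal h T c
  have hJ := sum_log_div_dist_le hR hM (analyticOnNhd_lineRe hh)
    (by rw [hcre]; exact_mod_cast (hm.trans_le hc).ne') (fun z hz => by
      have e1 : ‖h (z + T * I)‖ ≤ M := hb _ (by simpa [dist_eq_norm] using hz)
      have e2 : ‖h (conj z + T * I)‖ ≤ M := by
        apply hb
        rw [mem_closedBall, dist_eq_norm] at hz ⊢
        rw [add_sub_add_right_eq_sub, ← conj_ofReal, ← map_sub, norm_conj]
        exact hz
      rw [lineRe, norm_div]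
      have e3 := norm_add_le (h (z + T * I)) (conj (h (conj z + T * I)))
      rw [norm_conj] at e3
      rw [Complex.norm_ofNat, div_le_iff₀ (by norm_num)]
      linarith)
    (J.image fun j => (y j : ℂ)) (by
      intro u hu
      obtain ⟨j, hj, rfl⟩ := Finset.mem_image.1 hu
      refine ⟨?_, hzero _ (hy j hj).1 j (hy j hj).2.1⟩
      rw [mem_closedBall, dist_eq_norm, ← ofReal_sub, norm_real, Real.norm_eq_abs, abs_le]
      constructor <;> linarith [(hy j hj).1.1, (hy j hj).1.2])
  rw [Finset.sum_image hinj, hcre, norm_real, Real.norm_eq_abs,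
    abs_of_pos (hm.trans_le hc)] at hJ
  have hlen : ∀ j ∈ J, y j - (c - R) ≤ R * Real.log (R / ‖(c : ℂ) - y j‖) := by
    intro j hj
    have hpos : 0 < c - y j := by linarith [hymem j hj]
    rw [← ofReal_sub, norm_real, Real.norm_eq_abs, abs_of_pos hpos]
    have := Real.one_sub_inv_le_log_of_pos (div_pos hR hpos)
    rw [inv_div] at this
    calc y j - (c - R) = R * (1 - (c - y j) / R) := by field_simp; ring
      _ ≤ _ := by gcongr
  have hlogm : Real.log m ≤ Real.log (h (c + T * I)).re := Real.log_le_log hm hc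
  have h2 : ∑ j ∈ J, Real.pi * (y j - (c - R)) ≤ Real.pi * R * (Real.log M - Real.log m) := by
    calc ∑ j ∈ J, Real.pi * (y j - (c - R))
        ≤ ∑ j ∈ J, Real.pi * (R * Real.log (R / ‖(c : ℂ) - y j‖)) :=
          Finset.sum_le_sum fun j hj => mul_le_mul_of_nonneg_left (hlen j hj) Real.pi_pos.le
      _ = Real.pi * R * ∑ j ∈ J, Real.log (R / ‖(c : ℂ) - y j‖) := by
          rw [Finset.mul_sum]; exact Finset.sum_congr rfl fun j _ => by ring
      _ ≤ _ := by
          have : 0 ≤ Real.pi * R := by positivity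
          exact mul_le_mul_of_nonneg_left (by linarith) this
  linarith

end ZeroCounting

/-! ### A zero count for general analytic functions -/

namespace ZeroCounting

open Complex Set MeasureTheory Filter Topology Metric

/-- Along a vertical edge where `h` has positive real part, a continuous argument of `h` stays
within `π / 2` of one multiple of `2π`. -/
lemma exists_int_abs_sub_lt {h : ℂ → ℂ} {c b d : ℝ} (hbd : b ≤ d) {θ : ℝ → ℝ}
    (hθ : ContinuousOn θ (Icc b d))
    (hpol : ∀ t ∈ Icc b d, h (c + t * I) = ‖h (c + t * I)‖ * exp (θ t * I))
    (hpos : ∀ t ∈ Icc b d, 0 < (h (c + t * I)).re) :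
    ∃ k : ℤ, ∀ t ∈ Icc b d, |θ t - 2 * Real.pi * k| < Real.pi / 2 := by
  have hcos : ∀ t ∈ Icc b d, 0 < Real.cos (θ t) := by
    intro t ht
    have h1 := hpos t ht
    rw [hpol t ht, re_ofReal_mul, exp_ofReal_mul_I_re] at h1
    exact pos_of_mul_pos_right h1 (norm_nonneg _)
  set k : ℤ := round (θ b / (2 * Real.pi)) with hk
  have hcosk : ∀ t, Real.cos |θ t - 2 * Real.pi * k| = Real.cos (θ t) := by
    intro t
    rw [Real.cos_abs, ← Real.cos_sub_int_mul_two_pi (θ t) k]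
    congr 1; ring
  have hb : |θ b - 2 * Real.pi * k| < Real.pi / 2 := by
    by_contra hcon
    rw [not_lt] at hcon
    have h1 : |θ b - 2 * Real.pi * k| ≤ Real.pi := by
      have h2 := abs_sub_round (θ b / (2 * Real.pi))
      have h3 : θ b - 2 * Real.pi * k = (θ b / (2 * Real.pi) - k) * (2 * Real.pi) := by
        field_simp
      rw [h3, abs_mul, abs_of_pos Real.two_pi_pos]
      nlinarith [Real.pi_pos]
    have h2 : Real.cos |θ b - 2 * Real.pi * k| ≤ 0 :=
      Real.cos_nonpos_of_pi_div_two_le_of_le hcon (by linarith [Real.pi_pos])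
    rw [hcosk] at h2
    exact absurd (hcos b ⟨le_rfl, hbd⟩) (not_lt.2 h2)
  refine ⟨k, fun t ht => ?_⟩
  by_contra hcon
  rw [not_lt] at hcon
  have hc : ContinuousOn (fun t => |θ t - 2 * Real.pi * k|) (Icc b t) :=
    ((hθ.sub continuousOn_const).abs).mono (Icc_subset_Icc_right ht.2)
  obtain ⟨u, hu, hue⟩ := intermediate_value_Icc ht.1 hc ⟨hb.le, hcon⟩
  have h1 := hcos u ⟨hu.1, hu.2.trans ht.2⟩
  rw [← hcosk u] at h1
  simp only at hue
  rw [hue, Real.cos_pi_div_two] at h1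
  exact lt_irrefl _ h1

/-- Littlewood's lemma with the arguments on the horizontal edges bounded by Backlund's trick. -/
theorem two_pi_mul_sum_order_le {h : ℂ → ℂ} {a c b d M m : ℝ} (hac : a < c) (hbd : b < d)
    (hM : 1 ≤ M) (hm : 0 < m)
    (hQ : AnalyticOnNhd ℂ h (Icc a c ×ℂ Icc b d))
    (h0 : ∀ z ∈ Icc a c ×ℂ Icc b d, h z = 0 → z ∈ Ioo a c ×ℂ Ioo b d)
    (hpos : ∀ t ∈ Icc b d, m ≤ (h (c + t * I)).re)
    (ht : AnalyticOnNhd ℂ h (closedBall (c + d * I) (c - a)))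
    (hb : AnalyticOnNhd ℂ h (closedBall (c + b * I) (c - a)))
    (htM : ∀ z ∈ closedBall (c + d * I : ℂ) (c - a), ‖h z‖ ≤ M)
    (hbM : ∀ z ∈ closedBall (c + b * I : ℂ) (c - a), ‖h z‖ ≤ M)
    (s : Finset ℂ) (hs : ∀ z ∈ s, z ∈ Icc a c ×ℂ Icc b d ∧ h z = 0) :
    2 * Real.pi * ∑ z ∈ s, analyticOrderNatAt h z * (z.re - a) ≤
      (∫ t in b..d, Real.log ‖h (a + t * I)‖) - (∫ t in b..d, Real.log ‖h (c + t * I)‖) +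
        2 * Real.pi * (c - a) * (Real.log M - Real.log m) + Real.pi * (c - a) := by
  obtain ⟨Z, hZ1, hZ2, θt, θb, θr, h1, h2, h3, h4, h5, h6, h7, h8, h9, h10, h11, h12, h13⟩ :=
    exists_littlewoodIdentity hac hbd hQ h0
  obtain ⟨k, hk⟩ := exists_int_abs_sub_lt hbd.le h3 h8 fun t ht => hm.trans_le (hpos t ht)
  have hR : 0 < c - a := sub_pos.2 hac
  have ca : c - (c - a) = a := by ring
  have Bt := integral_abs_arg_le hR hM hm ht htM (hpos d ⟨hbd.le, le_rfl⟩) (θ := θt) (k := k)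
    (by rwa [ca]) (by rwa [ca]) (by rw [h4]; exact hk d ⟨hbd.le, le_rfl⟩)
  have Bb := integral_abs_arg_le hR hM hm hb hbM (hpos b ⟨le_rfl, hbd.le⟩) (θ := θb) (k := k)
    (by rwa [ca]) (by rwa [ca]) (by rw [h5]; exact hk b ⟨le_rfl, hbd.le⟩)
  rw [ca] at Bt Bb
  have ii : ∀ {f : ℝ → ℝ}, ContinuousOn f (Icc a c) → IntervalIntegrable f volume a c := by
    intro f hf
    apply ContinuousOn.intervalIntegrable
    rwa [uIcc_of_le hac.le]
  have hdiff : (∫ x in a..c, θt x) - (∫ x in a..c, θb x) ≤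
      (∫ x in a..c, |θt x - 2 * Real.pi * k|) + ∫ x in a..c, |θb x - 2 * Real.pi * k| := by
    have i1 : IntervalIntegrable (fun x => |θt x - 2 * Real.pi * k|) volume a c :=
      ii (h1.sub continuousOn_const).abs
    have i2 : IntervalIntegrable (fun x => |θb x - 2 * Real.pi * k|) volume a c :=
      ii (h2.sub continuousOn_const).abs
    rw [← intervalIntegral.integral_sub (ii h1) (ii h2), ← intervalIntegral.integral_add i1 i2]
    refine intervalIntegral.integral_mono_on hac.le ((ii h1).sub (ii h2)) (i1.add i2) fun x _ => ?_
    have e1 := le_abs_self (θt x - 2 * Real.pi * k)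
    have e2 := neg_le_abs (θb x - 2 * Real.pi * k)
    linarith
  have hsum : ∑ z ∈ s, analyticOrderNatAt h z * (z.re - a) ≤
      ∑ z ∈ Z, analyticOrderNatAt h z * (z.re - a) := by
    refine Finset.sum_le_sum_of_subset_of_nonneg (fun z hz => hZ1 z (hs z hz).1 (hs z hz).2) ?_
    intro z hz _
    have := (mem_reProdIm.1 (hZ2 z hz)).1.1
    exact mul_nonneg (Nat.cast_nonneg _) (by linarith)
  have := mul_le_mul_of_nonneg_left hsum Real.two_pi_pos.le
  linarith

end ZeroCounting

/-! ### The zeta function to the right of the imaginary axis -/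

namespace ZeroCounting

open Complex Set MeasureTheory Filter Topology

/-- The function equal to `t - ⌊t⌋` for `t > 1` and to `0` elsewhere. -/
noncomputable def fractTail (t : ℝ) : ℂ := indicator (Ioi 1) (fun t : ℝ => ((Int.fract t : ℝ) : ℂ)) t

/-- `∫₁^∞ {t} t^(-s-1) dt`, as a Mellin transform. -/
noncomputable def fractIntegral (s : ℂ) : ℂ := mellin fractTail (-s)

lemma norm_fractTail_le (t : ℝ) : ‖fractTail t‖ ≤ 1 := by
  rw [fractTail]
  by_cases ht : t ∈ Ioi (1 : ℝ)
  · rw [indicator_of_mem ht, norm_real, Real.norm_eq_abs, abs_of_nonneg (Int.fract_nonneg t)]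
    exact (Int.fract_lt_one t).le
  · rw [indicator_of_notMem ht]; simp

lemma measurable_fractTail : Measurable fractTail :=
  (measurable_ofReal.comp measurable_fract).indicator measurableSet_Ioi

lemma fractIntegral_eq (s : ℂ) :
    fractIntegral s = ∫ t in Ioi (1 : ℝ), (t : ℂ) ^ (-s - 1) * ((Int.fract t : ℝ) : ℂ) := by
  rw [fractIntegral, mellin]
  have : ∀ t : ℝ, (t : ℂ) ^ (-s - 1) • fractTail t =
      indicator (Ioi 1) (fun t : ℝ => (t : ℂ) ^ (-s - 1) * ((Int.fract t : ℝ) : ℂ)) t := by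
    intro t
    rw [fractTail, smul_eq_mul]
    by_cases ht : t ∈ Ioi (1 : ℝ)
    · rw [indicator_of_mem ht, indicator_of_mem ht]
    · rw [indicator_of_notMem ht, indicator_of_notMem ht, mul_zero]
  simp_rw [this]
  rw [setIntegral_indicator measurableSet_Ioi, inter_eq_right.2 (Ioi_subset_Ioi zero_le_one)]

lemma differentiableAt_fractIntegral {s : ℂ} (hs : 0 < s.re) :
    DifferentiableAt ℂ fractIntegral s := by
  have h : DifferentiableAt ℂ (mellin fractTail) (-s) := by
    refine mellin_differentiableAt_of_isBigO_rpow (a := 0) (b := -s.re - 1) ?_ ?_ (by simpa) ?_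
      (by simp)
    · refine LocallyIntegrable.locallyIntegrableOn ?_ _
      refine (locallyIntegrable_const (1 : ℂ)).mono measurable_fractTail.aestronglyMeasurable ?_
      exact ae_of_all _ fun t => by simpa using norm_fractTail_le t
    · refine Asymptotics.IsBigO.of_bound 1 (Eventually.of_forall fun t => ?_)
      simpa using norm_fractTail_le t
    · refine Asymptotics.IsBigO.of_bound 0 ?_
      have : ∀ᶠ t in 𝓝[>] (0 : ℝ), t < 1 :=
        eventually_nhdsWithin_of_eventually_nhds (eventually_lt_nhds zero_lt_one)
      filter_upwards [this] with t ht
      rw [fractTail, indicator_of_notMem (by simpa using ht.le)]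
      simp
  exact h.comp s differentiableAt_id.neg

lemma norm_fractIntegral_le {s : ℂ} (hs : 0 < s.re) : ‖fractIntegral s‖ ≤ 1 / s.re := by
  rw [fractIntegral_eq]
  have hi := integral_Ioi_rpow_of_lt (a := -s.re - 1) (by linarith) zero_lt_one
  have hI := integrableOn_Ioi_rpow_of_lt (a := -s.re - 1) (by linarith) zero_lt_one
  calc ‖∫ t in Ioi (1 : ℝ), (t : ℂ) ^ (-s - 1) * ((Int.fract t : ℝ) : ℂ)‖
      ≤ ∫ t in Ioi (1 : ℝ), t ^ (-s.re - 1) := by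
        refine norm_integral_le_of_norm_le hI ?_
        refine (ae_restrict_iff' measurableSet_Ioi).2 (ae_of_all _ fun t ht => ?_)
        have ht0 : 0 < t := zero_lt_one.trans ht
        rw [norm_mul, norm_cpow_eq_rpow_re_of_pos ht0, norm_real, Real.norm_eq_abs,
          abs_of_nonneg (Int.fract_nonneg t)]
        have h1 : 0 ≤ t ^ (-s - 1).re := Real.rpow_nonneg ht0.le _
        calc t ^ (-s - 1).re * Int.fract t ≤ t ^ (-s - 1).re * 1 := by
              gcongr; exact (Int.fract_lt_one t).le
          _ = t ^ (-s.re - 1) := by simp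
    _ = 1 / s.re := by
        rw [hi]
        simp only [sub_add_cancel, Real.one_rpow]
        rw [neg_div_neg_eq]

lemma integrableOn_cpow_mul_fract {s : ℂ} (hs : 0 < s.re) :
    IntegrableOn (fun t : ℝ => (t : ℂ) ^ (-s - 1) * ((Int.fract t : ℝ) : ℂ)) (Ioi 1) := by
  have hI := integrableOn_Ioi_cpow_of_lt (a := -s - 1) (by simp; linarith) zero_lt_one
  refine hI.mul_bdd (c := 1) (measurable_ofReal.comp measurable_fract).aestronglyMeasurable ?_
  refine ae_of_all _ fun t => ?_
  rw [norm_real, Real.norm_eq_abs, abs_of_nonneg (Int.fract_nonneg t)]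
  exact (Int.fract_lt_one t).le

lemma riemannZeta_eq_of_one_lt {s : ℂ} (hs : 1 < s.re) :
    riemannZeta s = s / (s - 1) - s * fractIntegral s := by
  have h1 := LSeries_eq_mul_integral_of_nonneg (fun _ => (1 : ℝ)) (r := 1) zero_le_one hs
    (by
      refine Asymptotics.IsBigO.of_bound 1 (Eventually.of_forall fun n => ?_)
      simp)
    (fun _ => zero_le_one)
  have h2 : LSeries (fun _ => ((1 : ℝ) : ℂ)) s = riemannZeta s := by
    rw [← LSeries_one_eq_riemannZeta hs]
    congr 1
  have hs1 : s - 1 ≠ 0 := by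
    intro e
    have := congrArg re e
    simp at this
    linarith
  have h3 : ∫ t in Ioi (1 : ℝ), (t : ℂ) ^ (-s) = 1 / (s - 1) := by
    rw [integral_Ioi_cpow_of_lt (by simpa using hs) zero_lt_one]
    have : -s + 1 ≠ 0 := fun e => hs1 (by linear_combination -e)
    simp only [ofReal_one, one_cpow]
    field_simp
    ring
  rw [h2] at h1
  rw [h1, fractIntegral_eq]
  have h4 : ∫ t in Ioi (1 : ℝ), (∑ k ∈ Finset.Icc 1 ⌊t⌋₊, ((1 : ℝ) : ℂ)) * (t : ℂ) ^ (-(s + 1)) =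
      ∫ t in Ioi (1 : ℝ), ((t : ℂ) ^ (-s) - (t : ℂ) ^ (-s - 1) * ((Int.fract t : ℝ) : ℂ)) := by
    refine setIntegral_congr_fun measurableSet_Ioi fun t ht => ?_
    have ht0 : (0 : ℝ) < t := zero_lt_one.trans ht
    have htc : (t : ℂ) ≠ 0 := ofReal_ne_zero.2 ht0.ne'
    have e1 : (t : ℂ) ^ (-s) = (t : ℂ) ^ (-s - 1) * t := by
      rw [cpow_sub _ _ htc, cpow_one]; field_simp
    have e2 : ((⌊t⌋₊ : ℕ) : ℝ) = t - Int.fract t := by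
      rw [natCast_floor_eq_intCast_floor ht0.le]
      exact (Int.self_sub_fract t).symm
    have e3 : ((⌊t⌋₊ : ℕ) : ℂ) = t - ((Int.fract t : ℝ) : ℂ) := by exact_mod_cast congrArg ofReal e2
    simp only [ofReal_one, Finset.sum_const, Nat.card_Icc, add_tsub_cancel_right, nsmul_eq_mul,
      mul_one]
    rw [e1, e3, neg_add']
    ring
  rw [h4, integral_sub (integrableOn_Ioi_cpow_of_lt (by simpa using hs) zero_lt_one)
    (integrableOn_cpow_mul_fract (by linarith)), h3]
  field_simp

/-- The integral representation of `ζ`, continued to `Re s > 0`. -/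
theorem riemannZeta_eq_of_pos {s : ℂ} (hs : 0 < s.re) (h1 : s ≠ 1) :
    riemannZeta s = s / (s - 1) - s * fractIntegral s := by
  have hopen : IsOpen {s : ℂ | 0 < s.re} := isOpen_lt continuous_const continuous_re
  have hf : AnalyticOnNhd ℂ (fun s => 1 - riemannZeta₀ s) {s : ℂ | 0 < s.re} :=
    DifferentiableOn.analyticOnNhd (by fun_prop) hopen
  have hg : AnalyticOnNhd ℂ (fun s => s * fractIntegral s) {s : ℂ | 0 < s.re} :=
    DifferentiableOn.analyticOnNhd (fun z hz => (differentiableAt_id.mul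
      (differentiableAt_fractIntegral hz)).differentiableWithinAt) hopen
  have hpre : IsPreconnected {s : ℂ | 0 < s.re} :=
    ((convex_Ioi (0 : ℝ)).linear_preimage reLm).isPreconnected
  have key : ∀ s : ℂ, s ≠ 1 → (riemannZeta s = s / (s - 1) - s * fractIntegral s ↔
      1 - riemannZeta₀ s = s * fractIntegral s) := by
    intro s hs
    rw [riemannZeta_eq_inv_sub_add hs]
    have : s - 1 ≠ 0 := sub_ne_zero.2 hs
    have e : s / (s - 1) = 1 + (s - 1)⁻¹ := by field_simp; ring
    rw [e]
    constructor
    · intro h; linear_combination -h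
    · intro h; linear_combination -h
  have heq := hf.eqOn_of_preconnected_of_eventuallyEq hg hpre (z₀ := 2) (by simp) (by
    have : ∀ᶠ s : ℂ in 𝓝 2, 1 < s.re :=
      continuous_re.continuousAt.eventually (eventually_gt_nhds (by simp))
    filter_upwards [this] with s hs
    have hs1 : s ≠ 1 := by rintro rfl; simp at hs
    exact (key s hs1).1 (riemannZeta_eq_of_one_lt hs))
  exact (key s h1).2 (heq hs)

end ZeroCounting

/-! ### The zeros of zeta of small height -/

namespace ZeroCounting

open Complex Set MeasureTheory Filter Topology Metric

/-- A zero of a factor of `h` has at most the multiplicity it has as a zero of `h`, unless `h`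
vanishes identically. -/
lemma analyticOrderNatAt_le_of_eventuallyEq_mul {f k h : ℂ → ℂ} {W : Set ℂ} {z w : ℂ}
    (hW : IsPreconnected W) (hh : AnalyticOnNhd ℂ h W) (hz : z ∈ W) (hw : w ∈ W) (hw0 : h w ≠ 0)
    (hf : AnalyticAt ℂ f z) (hk : AnalyticAt ℂ k z) (heq : h =ᶠ[𝓝 z] fun s => f s * k s) :
    analyticOrderNatAt f z ≤ analyticOrderNatAt h z := by
  have htop : analyticOrderAt h z ≠ ⊤ := by
    intro e
    rw [analyticOrderAt_eq_top] at e
    exact hw0 (hh.eqOn_zero_of_preconnected_of_eventuallyEq_zero hW hz e hw)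
  have hmul : analyticOrderAt h z = analyticOrderAt f z + analyticOrderAt k z := by
    rw [analyticOrderAt_congr heq]
    exact analyticOrderAt_mul hf hk
  rw [analyticOrderNatAt, analyticOrderNatAt]
  exact ENat.toNat_le_toNat (by rw [hmul]; exact le_self_add) htop

/-- An analytic function that is not identically zero has finitely many zeros in a compact
connected set. -/
lemma finite_zeros {h : ℂ → ℂ} {K : Set ℂ} {w : ℂ} (hK : IsCompact K) (hKp : IsPreconnected K)
    (hh : AnalyticOnNhd ℂ h K) (hw : w ∈ K) (hw0 : h w ≠ 0) : (K ∩ {z | h z = 0}).Finite := by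
  by_contra hinf
  obtain ⟨z, hz, hacc⟩ := Set.Infinite.exists_accPt_of_subset_isCompact hinf hK inter_subset_left
  have hfr : ∃ᶠ y in 𝓝[≠] z, h y = 0 :=
    (accPt_iff_frequently_nhdsNE.1 hacc).mono fun y hy => hy.2
  exact hw0 (hh.eqOn_zero_of_preconnected_of_frequently_eq_zero hKp hz hfr hw)

lemma exists_mem_Ioo_notMem {x y : ℝ} (hxy : x < y) {s : Set ℝ} (hs : s.Finite) :
    ∃ u ∈ Ioo x y, u ∉ s :=
  ((Ioo_infinite hxy).sdiff hs).nonempty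

lemma riemannZeta_zero_re_lt_one {z : ℂ} (hz : riemannZeta z = 0) : z.re < 1 := by
  by_contra h
  exact riemannZeta_ne_zero_of_one_le_re (not_lt.1 h) hz

/-- The function `(s - 1) ζ(s) / s`, analytic in `Re s > 0`. -/
noncomputable def zetaNoPole (s : ℂ) : ℂ := 1 - (s - 1) * fractIntegral s

lemma analyticOnNhd_zetaNoPole : AnalyticOnNhd ℂ zetaNoPole {s : ℂ | 0 < s.re} := by
  refine DifferentiableOn.analyticOnNhd (fun z hz => ?_)
    (isOpen_lt continuous_const continuous_re)
  have := differentiableAt_fractIntegral hz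
  unfold zetaNoPole
  exact DifferentiableAt.differentiableWithinAt (by fun_prop)

lemma zetaNoPole_eq {s : ℂ} (hs : 0 < s.re) (h1 : s ≠ 1) :
    zetaNoPole s = riemannZeta s * ((s - 1) / s) := by
  have hs0 : s ≠ 0 := by rintro rfl; simp at hs
  have : s - 1 ≠ 0 := sub_ne_zero.2 h1
  rw [riemannZeta_eq_of_pos hs h1, zetaNoPole]
  field_simp

lemma riemannZeta_eq_zero_of_zetaNoPole {s : ℂ} (hs : 0 < s.re) (h : zetaNoPole s = 0) :
    riemannZeta s = 0 := by
  have h1 : s ≠ 1 := by rintro rfl; simp [zetaNoPole] at h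
  have hs0 : s ≠ 0 := by rintro rfl; simp at hs
  rw [zetaNoPole_eq hs h1] at h
  exact (mul_eq_zero.1 h).resolve_right (div_ne_zero (sub_ne_zero.2 h1) hs0)

lemma norm_zetaNoPole_le {s : ℂ} (hs : 0 < s.re) : ‖zetaNoPole s‖ ≤ 1 + ‖s - 1‖ / s.re := by
  rw [zetaNoPole]
  refine (norm_sub_le _ _).trans ?_
  rw [norm_one, norm_mul, div_eq_mul_one_div ‖s - 1‖]
  have := norm_fractIntegral_le hs
  gcongr

lemma norm_riemannZeta_sub_one_le (t : ℝ) : ‖riemannZeta (2 + t * I) - 1‖ ≤ 0.65 := by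
  have hre : (2 + t * I : ℂ).re = 2 := by simp
  have hterm : ∀ n : ℕ, ‖1 / (n + 1 : ℂ) ^ (2 + t * I : ℂ)‖ = 1 / ((n : ℝ) + 1) ^ 2 := by
    intro n
    have : ((n : ℂ) + 1) = (((n : ℝ) + 1 : ℝ) : ℂ) := by push_cast; rfl
    rw [norm_div, norm_one, this, norm_cpow_eq_rpow_re_of_pos (by positivity), hre]
    norm_cast
  have h2 : HasSum (fun n : ℕ => 1 / ((n : ℝ) + 1) ^ 2) (Real.pi ^ 2 / 6) := by
    have := (hasSum_nat_add_iff' 1).2 hasSum_zeta_two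
    simpa using this
  have h3 : HasSum (fun n : ℕ => 1 / (((n + 1 : ℕ) : ℝ) + 1) ^ 2) (Real.pi ^ 2 / 6 - 1) := by
    have := (hasSum_nat_add_iff' 1).2 h2
    simpa using this
  have hs : Summable fun n : ℕ => 1 / (n + 1 : ℂ) ^ (2 + t * I : ℂ) := by
    apply Summable.of_norm
    simp_rw [hterm]
    exact h2.summable
  rw [zeta_eq_tsum_one_div_nat_add_one_cpow (by rw [hre]; norm_num), hs.tsum_eq_zero_add]
  have e0 : (1 : ℂ) / (((0 : ℕ) : ℂ) + 1) ^ (2 + t * I : ℂ) = 1 := by simp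
  rw [e0, add_sub_cancel_left]
  have h4 : ‖∑' n : ℕ, 1 / (((n + 1 : ℕ) : ℂ) + 1) ^ (2 + t * I : ℂ)‖ ≤ Real.pi ^ 2 / 6 - 1 := by
    refine tsum_of_norm_bounded h3 fun n => ?_
    exact (hterm (n + 1)).le
  have := Real.pi_lt_d4
  have := Real.pi_pos
  nlinarith

/-- With `w = (s - 1) / s`, the real part is at least `Re w - (ζ(2) - 1) ‖w‖`, and `‖w‖` is barely
larger than `Re w` on this line. -/
lemma re_zetaNoPole_ge (t : ℝ) : 1 / 8 ≤ (zetaNoPole (2 + t * I)).re := by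
  have hre : (2 + t * I : ℂ).re = 2 := by simp
  have h1 : (2 + t * I : ℂ) ≠ 1 := by
    intro e
    have := congrArg re e
    simp at this
  rw [zetaNoPole_eq (by rw [hre]; norm_num) h1]
  set w : ℂ := (2 + t * I - 1) / (2 + t * I) with hw
  set z : ℂ := riemannZeta (2 + t * I) - 1 with hz
  have hzn : ‖z‖ ≤ 0.65 := norm_riemannZeta_sub_one_le t
  have hzeta : riemannZeta (2 + t * I) = 1 + z := by rw [hz]; ring
  have hpos : 0 < 4 + t ^ 2 := by positivity
  have hwre : w.re = (2 + t ^ 2) / (4 + t ^ 2) := by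
    rw [hw, div_re]
    simp [normSq_apply]
    field_simp
    ring
  have hwn : ‖w‖ ^ 2 = (1 + t ^ 2) / (4 + t ^ 2) := by
    rw [← normSq_eq_norm_sq, hw, normSq_div]
    simp [normSq_apply]
    congr 1 <;> ring
  have hwle : ‖w‖ ≤ 1.07 * w.re := by
    have h0 : 0 ≤ 1.07 * w.re := by rw [hwre]; positivity
    refine le_of_sq_le_sq ?_ h0
    rw [hwn, hwre, mul_pow, div_pow, div_le_iff₀ hpos]
    have : (1.07 : ℝ) ^ 2 * ((2 + t ^ 2) ^ 2 / (4 + t ^ 2) ^ 2) * (4 + t ^ 2) =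
        1.07 ^ 2 * (2 + t ^ 2) ^ 2 / (4 + t ^ 2) := by field_simp
    rw [this, le_div_iff₀ hpos]
    nlinarith [sq_nonneg (t ^ 2 - 1.45)]
  have hwhalf : 1 / 2 ≤ w.re := by
    rw [hwre, div_le_div_iff₀ (by norm_num) hpos]
    nlinarith [sq_nonneg t]
  have hzw : -(0.65 * ‖w‖) ≤ (z * w).re := by
    have h2 := abs_re_le_norm (z * w)
    rw [norm_mul] at h2
    have h3 : ‖z‖ * ‖w‖ ≤ 0.65 * ‖w‖ := by gcongr
    linarith [(abs_le.1 h2).1]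
  rw [hzeta, add_mul, one_mul, add_re]
  linarith

/-- The zeros of `ζ` right of the critical line with ordinates in `[0, 15]`: the weighted count of
Littlewood's lemma, applied to `(s - 1) ζ(s) / s`, is at most `27`. -/
theorem sum_order_low_zeros_le (s : Finset ℂ)
    (hs : ∀ z ∈ s, riemannZeta z = 0 ∧ 1 / 2 < z.re ∧ 0 ≤ z.im ∧ z.im ≤ 15) :
    ∑ z ∈ s, analyticOrderNatAt riemannZeta z * (z.re - 1 / 2) ≤ 27 := by
  set K : Set ℂ := Icc (2 / 5) 2 ×ℂ Icc (-1) 16 with hK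
  have hfin := (isCompact_Icc.reProdIm isCompact_Icc : IsCompact K).inter_riemannZetaZeros_finite
  obtain ⟨a, ha, haZ⟩ := exists_mem_Ioo_notMem (show (2 / 5 : ℝ) < 1 / 2 by norm_num)
    (hfin.image re)
  obtain ⟨b, hb, hbZ⟩ := exists_mem_Ioo_notMem (show (-1 : ℝ) < 0 by norm_num) (hfin.image im)
  obtain ⟨d, hd, hdZ⟩ := exists_mem_Ioo_notMem (show (15 : ℝ) < 16 by norm_num) (hfin.image im)
  have hpre : IsPreconnected {s : ℂ | 0 < s.re} :=
    ((convex_Ioi (0 : ℝ)).linear_preimage reLm).isPreconnected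
  have hQre : ∀ z ∈ Icc a 2 ×ℂ Icc b d, 0 < z.re := fun z hz => by
    linarith [(mem_reProdIm.1 hz).1.1, ha.1]
  have hQ0 : ∀ z ∈ Icc a 2 ×ℂ Icc b d, zetaNoPole z = 0 → z ∈ Ioo a 2 ×ℂ Ioo b d := by
    intro z hz hz0
    have hζ := riemannZeta_eq_zero_of_zetaNoPole (hQre z hz) hz0
    have hlt := riemannZeta_zero_re_lt_one hζ
    obtain ⟨⟨h1, h2⟩, h3, h4⟩ := mem_reProdIm.1 hz
    have hzK : z ∈ K ∩ riemannZetaZeros := by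
      refine ⟨mem_reProdIm.2 ⟨⟨?_, ?_⟩, ?_, ?_⟩, hζ⟩ <;> linarith [ha.1, hb.1, hd.2]
    refine mem_reProdIm.2 ⟨⟨lt_of_le_of_ne h1 ?_, by linarith⟩, lt_of_le_of_ne h3 ?_,
      lt_of_le_of_ne h4 ?_⟩
    · intro e; exact haZ ⟨z, hzK, e.symm⟩
    · intro e; exact hbZ ⟨z, hzK, e.symm⟩
    · intro e; exact hdZ ⟨z, hzK, e⟩
  -- the left edge and both discs lie in `‖z - 1‖ ≤ 18.8`, where `1 + ‖z - 1‖ / a ≤ 48`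
  have hnear : ∀ z : ℂ, a ≤ z.re → ‖z - 1‖ ≤ 18.8 → ‖zetaNoPole z‖ ≤ 48 := by
    intro z hz hz1
    have h0 : 0 < z.re := by linarith [ha.1]
    refine (norm_zetaNoPole_le h0).trans ?_
    have : ‖z - 1‖ / z.re ≤ 47 := by
      rw [div_le_iff₀ h0]
      nlinarith [ha.1]
    linarith
  have hball : ∀ e : ℝ, |e| ≤ 16 → ∀ z ∈ closedBall (((2 : ℝ) : ℂ) + e * I) (2 - a),
      a ≤ z.re ∧ ‖z - 1‖ ≤ 18.8 := by
    intro e he z hz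
    rw [mem_closedBall, dist_eq_norm] at hz
    constructor
    · have := (abs_le.1 ((abs_re_le_norm _).trans hz)).1
      simp at this
      linarith
    · have e1 : z - 1 = (z - (((2 : ℝ) : ℂ) + e * I)) + (1 + e * I) := by push_cast; ring
      have e2 : ‖(1 + e * I : ℂ)‖ ≤ 1 + |e| := by
        refine (norm_add_le _ _).trans ?_
        simp
      rw [e1]
      refine (norm_add_le _ _).trans ?_
      linarith [ha.1]
  have hbabs : |b| ≤ 16 := by rw [abs_le]; constructor <;> linarith [hb.1, hb.2]
  have hdabs : |d| ≤ 16 := by rw [abs_le]; constructor <;> linarith [hd.1, hd.2]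
  have hbd : b < d := by linarith [hb.2, hd.1]
  have hpos : ∀ e : ℝ, |e| ≤ 16 →
      AnalyticOnNhd ℂ zetaNoPole (closedBall (((2 : ℝ) : ℂ) + e * I) (2 - a)) := fun e he =>
    analyticOnNhd_zetaNoPole.mono fun z hz => by
      have := (hball e he z hz).1
      simp only [mem_ofPred_eq]
      linarith [ha.1]
  have hmem : ∀ z ∈ s, z ∈ Icc a 2 ×ℂ Icc b d ∧ zetaNoPole z = 0 := by
    intro z hz
    obtain ⟨h1, h2, h3, h4⟩ := hs z hz
    have hlt := riemannZeta_zero_re_lt_one h1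
    refine ⟨mem_reProdIm.2 ⟨⟨?_, ?_⟩, ?_, ?_⟩, ?_⟩
    any_goals linarith [ha.2, hb.2, hd.1]
    rw [zetaNoPole_eq (by linarith) (by rintro rfl; simp at hlt), h1, zero_mul]
  have key := two_pi_mul_sum_order_le (h := zetaNoPole) (a := a) (c := 2) (b := b) (d := d)
    (M := 48) (m := 1 / 8) (by linarith [ha.2]) hbd (by norm_num) (by norm_num)
    (analyticOnNhd_zetaNoPole.mono hQre) hQ0 (fun t _ => by simpa using re_zetaNoPole_ge t)
    (hpos d hdabs) (hpos b hbabs) (fun z hz => hnear z (hball d hdabs z hz).1 (hball d hdabs z hz).2)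
    (fun z hz => hnear z (hball b hbabs z hz).1 (hball b hbabs z hz).2) s hmem
  have hlog : Real.log 48 - Real.log (1 / 8) ≤ 6 := by
    rw [← Real.log_div (by norm_num) (by norm_num), Real.log_le_iff_le_exp (by norm_num)]
    have h1 := Real.exp_one_gt_d9
    have h2 : Real.exp 6 = Real.exp 1 ^ 6 := by rw [← Real.exp_nat_mul]; norm_num
    rw [h2]
    calc (48 / (1 / 8) : ℝ) ≤ 2.7182818283 ^ 6 := by norm_num
      _ ≤ _ := by gcongr
  have hlog48 : 0 ≤ Real.log 48 := Real.log_nonneg (by norm_num)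
  have hlog8 : 0 ≤ -Real.log (1 / 8) := by
    rw [neg_nonneg]; exact Real.log_nonpos (by norm_num) (by norm_num)
  have hconst : ∀ C : ℝ, IntervalIntegrable (fun _ : ℝ => C) volume b d := fun C =>
    intervalIntegrable_const
  have hcl : ContinuousOn (fun t : ℝ => zetaNoPole (a + t * I)) (Icc b d) := by
    refine analyticOnNhd_zetaNoPole.continuousOn.comp (by fun_prop) fun t _ => ?_
    simp
    linarith [ha.1]
  have hcr : ContinuousOn (fun t : ℝ => zetaNoPole ((2 : ℝ) + t * I)) (Icc b d) := by
    refine analyticOnNhd_zetaNoPole.continuousOn.comp (by fun_prop) fun t _ => ?_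
    simp
  have hleft : (∫ t in b..d, Real.log ‖zetaNoPole (a + t * I)‖) ≤ 17 * Real.log 48 := by
    have h1 : (∫ t in b..d, Real.log ‖zetaNoPole (a + t * I)‖) ≤ ∫ _ in b..d, Real.log 48 := by
      have hmemQ : ∀ t ∈ Icc b d, (a + t * I : ℂ) ∈ Icc a 2 ×ℂ Icc b d := fun t ht => by
        simp only [mem_reProdIm, add_re, ofReal_re, mul_re, I_re, mul_zero, ofReal_im, I_im,
          mul_one, sub_self, add_zero, add_im, mul_im, zero_add]
        exact ⟨⟨le_rfl, by linarith [ha.2]⟩, ht⟩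
      have hne : ∀ t ∈ Icc b d, zetaNoPole (a + t * I) ≠ 0 := fun t ht h0 => by
        have := (mem_reProdIm.1 (hQ0 _ (hmemQ t ht) h0)).1.1
        simp at this
      refine intervalIntegral.integral_mono_on hbd.le
        (intervalIntegrable_log_norm hbd.le hcl hne) (hconst _) fun t ht => ?_
      refine Real.log_le_log (norm_pos_iff.2 (hne t ht)) (hnear _ (by simp) ?_)
      have e1 : (a + t * I - 1 : ℂ) = ((a - 1 : ℝ) : ℂ) + t * I := by push_cast; ring
      rw [e1]
      refine (norm_add_le _ _).trans ?_
      rw [norm_mul, norm_I, norm_real, norm_real, mul_one, Real.norm_eq_abs, Real.norm_eq_abs]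
      have e2 : |a - 1| ≤ 1 := by rw [abs_le]; constructor <;> linarith [ha.1, ha.2]
      have e3 : |t| ≤ 16 := by rw [abs_le]; constructor <;> linarith [ht.1, ht.2, hb.1, hd.2]
      linarith
    rw [intervalIntegral.integral_const, smul_eq_mul] at h1
    nlinarith [hb.1, hd.2]
  have hright : -(∫ t in b..d, Real.log ‖zetaNoPole ((2 : ℝ) + t * I)‖) ≤
      17 * -Real.log (1 / 8) := by
    have hne : ∀ t : ℝ, 1 / 8 ≤ ‖zetaNoPole ((2 : ℝ) + t * I)‖ := fun t => by
      have := re_zetaNoPole_ge t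
      push_cast
      exact this.trans (re_le_norm _)
    have h1 : (∫ _ in b..d, Real.log (1 / 8)) ≤
        ∫ t in b..d, Real.log ‖zetaNoPole ((2 : ℝ) + t * I)‖ := by
      refine intervalIntegral.integral_mono_on hbd.le (hconst _)
        (intervalIntegrable_log_norm hbd.le hcr fun t _ => norm_pos_iff.1 (by linarith [hne t]))
        fun t _ => ?_
      exact Real.log_le_log (by norm_num) (hne t)
    rw [intervalIntegral.integral_const, smul_eq_mul] at h1
    nlinarith [hb.1, hd.2]
  have hcomp : ∑ z ∈ s, analyticOrderNatAt riemannZeta z * (z.re - 1 / 2) ≤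
      ∑ z ∈ s, analyticOrderNatAt zetaNoPole z * (z.re - a) := by
    refine Finset.sum_le_sum fun z hz => ?_
    obtain ⟨h1, h2, -, -⟩ := hs z hz
    have hlt := riemannZeta_zero_re_lt_one h1
    have hz1 : z ≠ 1 := by rintro rfl; simp at hlt
    have hz0 : z ≠ 0 := by rintro rfl; norm_num at h2
    have hord : analyticOrderNatAt riemannZeta z ≤ analyticOrderNatAt zetaNoPole z := by
      refine analyticOrderNatAt_le_of_eventuallyEq_mul hpre analyticOnNhd_zetaNoPole
        (k := fun s => (s - 1) / s) (w := 1) (by simp only [mem_ofPred_eq]; linarith) (by simp)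
        (by simp [zetaNoPole]) (analyticOn_riemannZeta z hz1) ?_ ?_
      · exact AnalyticAt.div (by fun_prop) (by fun_prop) hz0
      · have e1 : ∀ᶠ s : ℂ in 𝓝 z, 0 < s.re :=
          continuous_re.continuousAt.eventually (eventually_gt_nhds (by linarith))
        filter_upwards [e1, eventually_ne_nhds hz1] with s hs hs1 using zetaNoPole_eq hs hs1
    have h3 : z.re - 1 / 2 ≤ z.re - a := by linarith [ha.2]
    have h4 : 0 ≤ z.re - 1 / 2 := by linarith
    have h5 : (analyticOrderNatAt riemannZeta z : ℝ) ≤ analyticOrderNatAt zetaNoPole z := by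
      exact_mod_cast hord
    exact mul_le_mul h5 h3 h4 (Nat.cast_nonneg _)
  have hpi := Real.pi_gt_d4
  have h2a : 2 - a ≤ 1.6 := by linarith [ha.1]
  have hfinal : 2 * Real.pi * (2 - a) * (Real.log 48 - Real.log (1 / 8)) ≤
      2 * Real.pi * 1.6 * 6 := by
    have : 0 ≤ Real.log 48 - Real.log (1 / 8) := by linarith
    gcongr
  have hfinal2 : Real.pi * (2 - a) ≤ Real.pi * 1.6 := by gcongr
  have htotal : 2 * Real.pi * ∑ z ∈ s, analyticOrderNatAt riemannZeta z * (z.re - 1 / 2) ≤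
      2 * Real.pi * 27 := by
    have := mul_le_mul_of_nonneg_left hcomp Real.two_pi_pos.le
    linarith
  exact le_of_mul_le_mul_left htotal Real.two_pi_pos

end ZeroCounting

/-! ### Estimates for the mollified zeta function -/

namespace ZeroCounting

open Complex Set MeasureTheory Filter Topology Metric

lemma differentiable_U (A : ℕ) : Differentiable ℂ (U A) := by
  unfold U
  refine Differentiable.fun_sum fun n hn => ?_
  have hn0 : (n : ℂ) ≠ 0 := by
    have := (Finset.mem_Icc.1 hn).1
    exact_mod_cast (by omega : n ≠ 0)
  intro s
  exact (differentiableAt_const _).div (differentiableAt_id.const_cpow (Or.inl hn0))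
    (by rw [Ne, cpow_eq_zero_iff]; tauto)

lemma differentiableAt_V (A : ℕ) {s : ℂ} (hs : s ≠ 1) : DifferentiableAt ℂ (V A) s := by
  unfold V
  exact ((differentiableAt_riemannZeta hs).mul (differentiable_U A s)).sub_const 1

lemma one_sub_V_sq (A : ℕ) (s : ℂ) :
    1 - V A s ^ 2 = riemannZeta s * (U A s * (2 - riemannZeta s * U A s)) := by
  rw [V]; ring

lemma analyticOnNhd_one_sub_V_sq (A : ℕ) :
    AnalyticOnNhd ℂ (fun s => 1 - V A s ^ 2) {s : ℂ | 0 < s.im} := by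
  refine DifferentiableOn.analyticOnNhd (fun z hz => ?_) (isOpen_lt continuous_const continuous_im)
  have hz1 : z ≠ 1 := by rintro rfl; simp at hz
  have := differentiableAt_V A hz1
  exact DifferentiableAt.differentiableWithinAt (by fun_prop)

lemma sum_inv_sqrt_le (A : ℕ) : ∑ n ∈ Finset.Icc 1 A, (n : ℝ) ^ (-(1 / 2) : ℝ) ≤ 2 * √A := by
  induction A with
  | zero => simp
  | succ A ih =>
    rw [Finset.sum_Icc_succ_top (by omega)]
    have hpos : 0 < √((A : ℝ) + 1) := Real.sqrt_pos.2 (by positivity)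
    have h1 : ((A + 1 : ℕ) : ℝ) ^ (-(1 / 2) : ℝ) = 1 / √((A : ℝ) + 1) := by
      rw [Real.rpow_neg (by positivity), ← Real.sqrt_eq_rpow, one_div]; push_cast; rfl
    have h2 : 1 / √((A : ℝ) + 1) ≤ 2 * √((A : ℝ) + 1) - 2 * √A := by
      rw [div_le_iff₀ hpos]
      have e1 := Real.sq_sqrt (by positivity : (0 : ℝ) ≤ (A : ℝ) + 1)
      have e2 := Real.sq_sqrt (by positivity : (0 : ℝ) ≤ (A : ℝ))
      nlinarith [sq_nonneg (√((A : ℝ) + 1) - √A)]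
    rw [h1]
    push_cast
    linarith

lemma norm_moebius_le_one (n : ℕ) : ‖((ArithmeticFunction.moebius n : ℤ) : ℂ)‖ ≤ 1 := by
  rw [norm_intCast]
  exact_mod_cast ArithmeticFunction.abs_moebius_le_one (n := n)

lemma norm_U_le (A : ℕ) {s : ℂ} (hs : 1 / 2 ≤ s.re) : ‖U A s‖ ≤ 2 * √A := by
  refine le_trans (norm_sum_le _ _) (le_trans (Finset.sum_le_sum fun n hn => ?_)
    (sum_inv_sqrt_le A))
  have hn1 : 1 ≤ n := (Finset.mem_Icc.1 hn).1
  have hn0 : (0 : ℝ) < n := by exact_mod_cast hn1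
  have hn1' : (1 : ℝ) ≤ n := by exact_mod_cast hn1
  rw [norm_div, norm_natCast_cpow_of_pos hn1, Real.rpow_neg hn0.le, ← one_div]
  have h1 : (n : ℝ) ^ (1 / 2 : ℝ) ≤ (n : ℝ) ^ s.re := Real.rpow_le_rpow_of_exponent_le hn1' hs
  have h2 : 0 < (n : ℝ) ^ (1 / 2 : ℝ) := Real.rpow_pos_of_pos hn0 _
  exact div_le_div₀ zero_le_one (norm_moebius_le_one n) h2 h1

lemma norm_riemannZeta_le {s : ℂ} {H : ℝ} (hre : 1 / 2 ≤ s.re) (him : 12 ≤ s.im) (hH : s.im ≤ H) :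
    ‖riemannZeta s‖ ≤ 2 * H + 2.1 := by
  have hs1 : s ≠ 1 := by rintro rfl; norm_num at him
  have hre0 : 0 < s.re := by linarith
  rw [riemannZeta_eq_of_pos hre0 hs1]
  have e : s / (s - 1) = 1 + 1 / (s - 1) := by
    have : s - 1 ≠ 0 := sub_ne_zero.2 hs1
    field_simp; ring
  have h1 : ‖1 / (s - 1)‖ ≤ 0.1 := by
    have h2 : 12 ≤ ‖s - 1‖ := by
      have := abs_im_le_norm (s - 1)
      simp only [sub_im, one_im, sub_zero] at this
      linarith [le_abs_self s.im]
    rw [norm_div, norm_one, div_le_iff₀ (by linarith)]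
    linarith
  have h3 : ‖s * fractIntegral s‖ ≤ 1 + 2 * s.im := by
    have h4 : ‖s‖ ≤ s.re + s.im := by
      have := norm_le_abs_re_add_abs_im s
      rwa [abs_of_pos hre0, abs_of_pos (by linarith : 0 < s.im)] at this
    calc ‖s * fractIntegral s‖ ≤ (s.re + s.im) * (1 / s.re) := by
          rw [norm_mul]
          exact mul_le_mul h4 (norm_fractIntegral_le hre0) (norm_nonneg _) (by linarith)
      _ = 1 + s.im / s.re := by field_simp
      _ ≤ 1 + 2 * s.im := by
          have : s.im / s.re ≤ 2 * s.im := by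
            rw [div_le_iff₀ hre0]; nlinarith
          linarith
  rw [e]
  have h5 := norm_sub_le (1 + 1 / (s - 1)) (s * fractIntegral s)
  have h6 := norm_add_le (1 : ℂ) (1 / (s - 1))
  rw [norm_one] at h6
  linarith

lemma le_X {A : ℕ} {T : ℝ} (hA : 16 ≤ A) (hT : 14 ≤ T) :
    32 / 9 * 3.9 * √A * (T + 7 / 4) ≤ X A T := by
  have hA' : (16 : ℝ) ≤ A := by exact_mod_cast hA
  have hA0 : (0 : ℝ) ≤ A := by linarith
  have hT0 : 0 ≤ T + 7 / 4 := by linarith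
  have e1 : (A : ℝ) ^ (3 / 4 : ℝ) = √A * (A : ℝ) ^ (1 / 4 : ℝ) := by
    rw [Real.sqrt_eq_rpow, ← Real.rpow_add (by linarith)]; norm_num
  have e2 : (T + 7 / 4) ^ (3 / 2 : ℝ) = (T + 7 / 4) * √(T + 7 / 4) := by
    rw [Real.sqrt_eq_rpow, ← Real.rpow_one_add' hT0 (by norm_num)]; norm_num
  have h1 : (2 : ℝ) ≤ (A : ℝ) ^ (1 / 4 : ℝ) := by
    have : (16 : ℝ) ^ (1 / 4 : ℝ) = 2 := by
      rw [show (16 : ℝ) = 2 ^ (4 : ℝ) by norm_num, ← Real.rpow_mul (by norm_num)]; norm_num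
    rw [← this]
    exact Real.rpow_le_rpow (by norm_num) hA' (by norm_num)
  have h2 : (3.9 : ℝ) ≤ √(T + 7 / 4) := Real.le_sqrt_of_sq_le (by norm_num; linarith)
  have h3 : 0 ≤ b₁ * (A : ℝ) ^ (3 / 4 : ℝ) * (T + 7 / 4) ^ (1 / 2 : ℝ) := by
    have : (0 : ℝ) ≤ b₁ := by unfold b₁; norm_num
    positivity
  have h4 : 16 / 9 * (√A * 2) * ((T + 7 / 4) * 3.9) ≤
      16 / 9 * (√A * (A : ℝ) ^ (1 / 4 : ℝ)) * ((T + 7 / 4) * √(T + 7 / 4)) := by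
    gcongr
  rw [X, e1, e2]
  rw [e1] at h3
  linarith

lemma four_le_sqrt {A : ℕ} (hA : 16 ≤ A) : 4 ≤ √(A : ℝ) := by
  apply Real.le_sqrt_of_sq_le
  have : (16 : ℝ) ≤ A := by exact_mod_cast hA
  linarith

lemma exp_three_le_X {A : ℕ} {T : ℝ} (hA : 16 ≤ A) (hT : 14 ≤ T) : Real.exp 3 ≤ X A T := by
  have h1 := le_X hA hT
  have h2 := four_le_sqrt hA
  have h3 : Real.exp 3 ≤ 27 := by
    have h2 : Real.exp 3 = Real.exp 1 ^ 3 := by rw [← Real.exp_nat_mul]; norm_num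
    have := Real.exp_one_lt_d9
    rw [h2]
    calc Real.exp 1 ^ 3 ≤ 3 ^ 3 := by gcongr; linarith
      _ = 27 := by norm_num
  have h4 : 32 / 9 * 3.9 * 4 * (14 + 7 / 4) ≤ 32 / 9 * 3.9 * √(A : ℝ) * (T + 7 / 4) := by gcongr
  norm_num at h4
  linarith

lemma norm_zeta_mul_U_le {A : ℕ} {T : ℝ} (hA : 16 ≤ A) (hT : 14 ≤ T) {s : ℂ} (hre : 1 / 2 ≤ s.re)
    (him : 12 ≤ s.im) (himT : s.im ≤ T + 3 / 2) : ‖riemannZeta s * U A s‖ ≤ X A T := by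
  have h0 : 0 ≤ √(A : ℝ) := Real.sqrt_nonneg _
  refine le_trans ?_ (le_X hA hT)
  rw [norm_mul]
  calc ‖riemannZeta s‖ * ‖U A s‖ ≤ (2 * (T + 3 / 2) + 2.1) * (2 * √A) :=
        mul_le_mul (norm_riemannZeta_le hre him himT) (norm_U_le A hre) (norm_nonneg _)
          (by linarith)
    _ ≤ _ := by nlinarith

lemma norm_one_sub_V_sq_le {A : ℕ} {T : ℝ} (hA : 16 ≤ A) (hT : 14 ≤ T) {s : ℂ}
    (hre : 1 / 2 ≤ s.re) (him : 12 ≤ s.im) (himT : s.im ≤ T + 3 / 2) :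
    ‖1 - V A s ^ 2‖ ≤ X A T * (X A T + 2) := by
  have h1 := norm_zeta_mul_U_le hA hT hre him himT
  have h2 : ‖2 - riemannZeta s * U A s‖ ≤ X A T + 2 := by
    refine (norm_sub_le _ _).trans ?_
    rw [Complex.norm_ofNat]
    linarith
  rw [one_sub_V_sq, ← mul_assoc, norm_mul]
  exact mul_le_mul h1 h2 (norm_nonneg _) ((norm_nonneg _).trans h1)

lemma hasSum_inv_sub_inv {A : ℕ} (hA : 1 ≤ A) :
    HasSum (fun n : ℕ => 1 / ((n : ℝ) + A) - 1 / (((n + 1 : ℕ) : ℝ) + A)) (1 / A) := by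
  have hA' : (1 : ℝ) ≤ A := by exact_mod_cast hA
  rw [hasSum_iff_tendsto_nat_of_nonneg]
  · have h1 : ∀ n : ℕ, ∑ i ∈ Finset.range n,
        (1 / ((i : ℝ) + A) - 1 / (((i + 1 : ℕ) : ℝ) + A)) = 1 / (A : ℝ) - 1 / ((n : ℝ) + A) := by
      intro n
      rw [Finset.sum_range_sub' (fun i : ℕ => 1 / ((i : ℝ) + A))]
      simp
    simp_rw [h1]
    have h2 : Tendsto (fun n : ℕ => 1 / ((n : ℝ) + A)) atTop (𝓝 0) :=
      tendsto_const_nhds.div_atTop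
        (tendsto_atTop_add_const_right _ _ tendsto_natCast_atTop_atTop)
    simpa using h2.const_sub (1 / (A : ℝ))
  · intro n
    rw [sub_nonneg]
    apply one_div_le_one_div_of_le (by positivity)
    push_cast
    linarith

/-- On the line `Re s = 2`, `V_A = -ζ · ∑_{n > A} μ(n) n^(-s)` is of size `1 / A`. -/
lemma norm_V_two_le {A : ℕ} (hA : 1 ≤ A) (t : ℝ) : ‖V A (2 + t * I)‖ ≤ 2 / A := by
  have hre : (2 + t * I : ℂ).re = 2 := by simp
  have h1re : 1 < (2 + t * I : ℂ).re := by rw [hre]; norm_num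
  have hA' : (1 : ℝ) ≤ A := by exact_mod_cast hA
  set s : ℂ := 2 + t * I with hs
  set f : ℕ → ℂ := LSeries.term (fun n => ((ArithmeticFunction.moebius n : ℤ) : ℂ)) s with hf
  have hsum : Summable f := ArithmeticFunction.LSeriesSummable_moebius_iff.2 h1re
  have hinv : riemannZeta s * ∑' n, f n = 1 := by
    have := ArithmeticFunction.LSeries_zeta_mul_Lseries_moebius h1re
    rwa [ArithmeticFunction.LSeries_zeta_eq_riemannZeta h1re] at this
  have hU : U A s = ∑ n ∈ Finset.range (A + 1), f n := by
    rw [U, Finset.range_eq_Ico, Finset.sum_eq_sum_Ico_succ_bot (by omega)]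
    have : f 0 = 0 := LSeries.term_zero _ _
    rw [this, zero_add]
    refine Finset.sum_congr rfl fun n hn => ?_
    have hn1 : n ≠ 0 := by
      have := (Finset.mem_Icc.1 hn).1
      omega
    rw [hf, LSeries.term_of_ne_zero hn1]
  have hsplit := hsum.sum_add_tsum_nat_add (A + 1)
  have htail : ‖∑' n, f (n + (A + 1))‖ ≤ 1 / A := by
    refine tsum_of_norm_bounded (hasSum_inv_sub_inv hA) fun n => ?_
    have hpos : 0 < n + (A + 1) := by omega
    rw [hf, LSeries.term_of_ne_zero hpos.ne', norm_div, norm_natCast_cpow_of_pos hpos, hre]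
    have e1 : (((n + (A + 1) : ℕ) : ℝ)) = (n : ℝ) + 1 + A := by push_cast; ring
    have e2 : (((n + 1 : ℕ) : ℝ)) = (n : ℝ) + 1 := by push_cast; ring
    have hp : 0 < (n : ℝ) + A := by positivity
    rw [e1, e2, div_sub_div _ _ hp.ne' (by positivity)]
    have e3 : (1 * ((n : ℝ) + 1 + A) - ((n : ℝ) + A) * 1) = 1 := by ring
    rw [e3, show (2 : ℝ) = ((2 : ℕ) : ℝ) by norm_num, Real.rpow_natCast]
    apply div_le_div₀ zero_le_one (norm_moebius_le_one _) (by positivity)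
    nlinarith
  have hV : V A s = -(riemannZeta s * ∑' n, f (n + (A + 1))) := by
    rw [V, hU, ← hinv, ← hsplit]; ring
  have hζ : ‖riemannZeta s‖ ≤ 2 := by
    have h2 := norm_riemannZeta_sub_one_le t
    have h3 := norm_add_le (riemannZeta s - 1) 1
    rw [sub_add_cancel, norm_one] at h3
    linarith
  rw [hV, norm_neg, norm_mul]
  calc ‖riemannZeta s‖ * ‖∑' n, f (n + (A + 1))‖ ≤ 2 * (1 / A) :=
        mul_le_mul hζ htail (norm_nonneg _) (by norm_num)
    _ = 2 / A := by ring

end ZeroCounting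

/-! ### The zeros of zeta of larger height -/

namespace ZeroCounting

open Complex Set MeasureTheory Filter Topology Metric

lemma continuous_V_line (A : ℕ) :
    Continuous fun p : ℝ × ℝ => V A (p.1 + I * (max p.2 1 : ℝ)) := by
  refine continuous_iff_continuousAt.2 fun p => ?_
  have hne : ((p.1 : ℂ) + I * (max p.2 1 : ℝ)) ≠ 1 := by
    intro e
    have := congrArg im e
    simp at this
    linarith [le_max_right p.2 1]
  refine ContinuousAt.comp (g := V A) (differentiableAt_V A hne).continuousAt ?_
  fun_prop

lemma integral_V_line_eq (A : ℕ) {p q : ℝ} (hp : 1 ≤ p) (hpq : p ≤ q) (a : ℝ) :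
    ∫ t in p..q, ‖V A (a + I * (max t 1 : ℝ))‖ ^ 2 = ∫ t in p..q, ‖V A (a + I * t)‖ ^ 2 := by
  refine intervalIntegral.integral_congr fun t ht => ?_
  rw [uIcc_of_le hpq] at ht
  simp only [max_eq_left (hp.trans ht.1)]

/-- The mean square of `V_A` on a vertical line depends continuously on the line. -/
lemma continuous_integral_V_line (A : ℕ) {p q : ℝ} (hp : 1 ≤ p) (hpq : p ≤ q) :
    Continuous fun a : ℝ => ∫ t in p..q, ‖V A (a + I * t)‖ ^ 2 := by
  simp_rw [← integral_V_line_eq A hp hpq]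
  have h1 : Continuous (Function.uncurry fun a t : ℝ => ‖V A (a + I * (max t 1 : ℝ))‖ ^ 2) := by
    simp only [Function.uncurry_def]
    exact (continuous_V_line A).norm.pow 2
  exact intervalIntegral.continuous_parametric_intervalIntegral_of_continuous' h1 p q

lemma intervalIntegrable_V_line (A : ℕ) {p q : ℝ} (hp : 1 ≤ p) (hpq : p ≤ q) (a : ℝ) :
    IntervalIntegrable (fun t : ℝ => ‖V A (a + I * t)‖ ^ 2) volume p q := by
  have h1 : Continuous fun t : ℝ => ‖V A (a + I * (max t 1 : ℝ))‖ ^ 2 :=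
    ((continuous_V_line A).comp (Continuous.prodMk_right a)).norm.pow 2
  refine (h1.intervalIntegrable p q).congr fun t ht => ?_
  rw [uIoc_of_le hpq] at ht
  simp only [max_eq_left (hp.trans ht.1.le)]

lemma log_norm_one_sub_sq_le (v : ℂ) : Real.log ‖1 - v ^ 2‖ ≤ ‖v‖ ^ 2 := by
  have h1 : ‖1 - v ^ 2‖ ≤ 1 + ‖v‖ ^ 2 := by
    refine (norm_sub_le _ _).trans ?_
    rw [norm_one, norm_pow]
  rcases eq_or_lt_of_le (norm_nonneg (1 - v ^ 2)) with h | h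
  · rw [← h, Real.log_zero]; positivity
  · linarith [Real.log_le_sub_one_of_pos h]

/-- The weighted count of Littlewood's lemma for the zeros of `ζ` with ordinates in `[15, T)`, for
all but finitely many left edges `Re s = a`. The function used is `1 - V_A ^ 2`, which `ζ`
divides. -/
theorem exists_finite_sum_order_high_zeros_le {A : ℕ} (hA : 16 ≤ A) {T : ℝ} (hT : 15 < T) :
    ∃ F : Set ℝ, F.Finite ∧ ∀ a : ℝ, a ∉ F → 1 / 2 ≤ a → a < 1 → ∀ s : Finset ℂ,
      (∀ z ∈ s, riemannZeta z = 0 ∧ a ≤ z.re ∧ 15 ≤ z.im ∧ z.im < T) →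
      2 * Real.pi * ∑ z ∈ s, analyticOrderNatAt riemannZeta z * (z.re - a) ≤
        (∫ t in (14 : ℝ)..T, ‖V A (a + I * t)‖ ^ 2) + 16 * T / A +
          2 * Real.pi * (3 / 2) * (Real.log (X A T) + Real.log (X A T + 2) + Real.log 2) +
          Real.pi * (3 / 2) := by
  set h : ℂ → ℂ := fun s => 1 - V A s ^ 2 with hh
  set K : Set ℂ := Icc (1 / 2) 2 ×ℂ Icc 14 T with hK
  have hA' : (16 : ℝ) ≤ A := by exact_mod_cast hA
  have hKim : K ⊆ {s : ℂ | 0 < s.im} := fun z hz => by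
    have := (mem_reProdIm.1 hz).2.1
    simp only [mem_ofPred_eq]; linarith
  have han := analyticOnNhd_one_sub_V_sq A
  have hV2 : ∀ t : ℝ, ‖V A ((2 : ℝ) + t * I)‖ ^ 2 ≤ 1 / (4 * A) := by
    intro t
    have h1 := norm_V_two_le (by omega : 1 ≤ A) t
    push_cast
    calc ‖V A (2 + t * I)‖ ^ 2 ≤ (2 / (A : ℝ)) ^ 2 := by gcongr
      _ = 4 / (A : ℝ) / A := by ring
      _ ≤ 1 / (4 * (A : ℝ)) := by
        rw [div_div, div_le_div_iff₀ (by positivity) (by positivity)]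
        nlinarith
  have hVhalf : ∀ t : ℝ, ‖V A ((2 : ℝ) + t * I)‖ ^ 2 ≤ 1 / 64 := fun t => by
    refine (hV2 t).trans ?_
    rw [div_le_div_iff₀ (by positivity) (by positivity)]
    linarith
  have hre2 : ∀ t : ℝ, 1 / 2 ≤ (h ((2 : ℝ) + t * I)).re := by
    intro t
    have h1 : (h ((2 : ℝ) + t * I)).re = 1 - (V A ((2 : ℝ) + t * I) ^ 2).re := by simp [hh]
    have h2 := re_le_norm (V A ((2 : ℝ) + t * I) ^ 2)
    rw [norm_pow] at h2
    rw [h1]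
    linarith [hVhalf t]
  have hne2 : ∀ z : ℂ, z.re = 2 → h z ≠ 0 := by
    intro z hz h0
    have h1 := hre2 z.im
    rw [show (((2 : ℝ) : ℂ) + z.im * I) = z by rw [← hz, re_add_im], h0, zero_re] at h1
    norm_num at h1
  have hfin : (K ∩ {z | h z = 0}).Finite :=
    finite_zeros (w := (2 : ℂ) + 14 * I) (isCompact_Icc.reProdIm isCompact_Icc)
      (convex_Icc_reProdIm_Icc _ _ _ _).isPreconnected (han.mono hKim)
      (by rw [hK, mem_reProdIm]; norm_num; linarith) (hne2 _ (by simp))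
  refine ⟨re '' (K ∩ {z | h z = 0}), hfin.image re, fun a haF ha ha1 s hs => ?_⟩
  obtain ⟨b, hb, hbF⟩ := exists_mem_Ioo_notMem (show (14 : ℝ) < 15 by norm_num) (hfin.image im)
  -- the top edge lies above all the given zeros and below height `T`
  obtain ⟨u, hu15, huT, hus⟩ : ∃ u, 15 ≤ u ∧ u < T ∧ ∀ z ∈ s, z.im ≤ u := by
    set S : Finset ℝ := insert 15 (s.image im) with hS
    have hSne : S.Nonempty := ⟨15, by simp [hS]⟩
    refine ⟨S.max' hSne, S.le_max' _ (by simp [hS]), ?_, fun z hz => S.le_max' _ ?_⟩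
    · rw [Finset.max'_lt_iff]
      intro y hy
      rcases Finset.mem_insert.1 hy with rfl | hy
      · exact hT
      · obtain ⟨z, hz, rfl⟩ := Finset.mem_image.1 hy
        exact (hs z hz).2.2.2
    · exact Finset.mem_insert_of_mem (Finset.mem_image_of_mem im hz)
  obtain ⟨d, hd, hdF⟩ := exists_mem_Ioo_notMem huT (hfin.image im)
  have hbd : b < d := by linarith [hb.2, hd.1]
  set Q : Set ℂ := Icc a 2 ×ℂ Icc b d with hQ
  have hQK : Q ⊆ K := fun z hz => by
    obtain ⟨⟨h1, h2⟩, h3, h4⟩ := mem_reProdIm.1 hz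
    refine mem_reProdIm.2 ⟨⟨?_, h2⟩, ?_, ?_⟩ <;> linarith [hb.1, hd.2]
  have hQ0 : ∀ z ∈ Q, h z = 0 → z ∈ Ioo a 2 ×ℂ Ioo b d := by
    intro z hz hz0
    obtain ⟨⟨h1, h2⟩, h3, h4⟩ := mem_reProdIm.1 hz
    have hzK : z ∈ K ∩ {z | h z = 0} := ⟨hQK hz, hz0⟩
    refine mem_reProdIm.2 ⟨⟨lt_of_le_of_ne h1 ?_, lt_of_le_of_ne h2 ?_⟩, lt_of_le_of_ne h3 ?_,
      lt_of_le_of_ne h4 ?_⟩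
    · intro e; exact haF ⟨z, hzK, e.symm⟩
    · intro e; exact hne2 z e hz0
    · intro e; exact hbF ⟨z, hzK, e.symm⟩
    · intro e; exact hdF ⟨z, hzK, e⟩
  have hball : ∀ e : ℝ, 14 ≤ e → e ≤ T → ∀ z ∈ closedBall (((2 : ℝ) : ℂ) + e * I) (2 - a),
      1 / 2 ≤ z.re ∧ 12 ≤ z.im ∧ z.im ≤ T + 3 / 2 := by
    intro e he heT z hz
    rw [mem_closedBall, dist_eq_norm] at hz
    have h1 := abs_le.1 ((abs_re_le_norm _).trans hz)
    have h2 := abs_le.1 ((abs_im_le_norm _).trans hz)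
    simp at h1 h2
    refine ⟨?_, ?_, ?_⟩ <;> linarith [h1.1, h2.1, h2.2]
  have hanb : ∀ e : ℝ, 14 ≤ e → e ≤ T →
      AnalyticOnNhd ℂ h (closedBall (((2 : ℝ) : ℂ) + e * I) (2 - a)) := fun e he heT =>
    han.mono fun z hz => by
      have := (hball e he heT z hz).2.1
      simp only [mem_ofPred_eq]; linarith
  have hMb : ∀ e : ℝ, 14 ≤ e → e ≤ T → ∀ z ∈ closedBall (((2 : ℝ) : ℂ) + e * I) (2 - a),
      ‖h z‖ ≤ X A T * (X A T + 2) := fun e he heT z hz =>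
    norm_one_sub_V_sq_le hA (by linarith) (hball e he heT z hz).1 (hball e he heT z hz).2.1
      (hball e he heT z hz).2.2
  have hX : 1 ≤ X A T := by
    have := exp_three_le_X hA (by linarith : 14 ≤ T)
    have h1 := Real.add_one_le_exp 3
    linarith
  have hmem : ∀ z ∈ s, z ∈ Q ∧ h z = 0 := by
    intro z hz
    obtain ⟨h1, h2, h3, h4⟩ := hs z hz
    have hlt := riemannZeta_zero_re_lt_one h1
    refine ⟨mem_reProdIm.2 ⟨⟨h2, by linarith⟩, by linarith [hb.2], by linarith [hus z hz, hd.1]⟩, ?_⟩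
    simp only [hh]
    rw [one_sub_V_sq, h1, zero_mul]
  have key := two_pi_mul_sum_order_le (h := h) (a := a) (c := 2) (b := b) (d := d)
    (M := X A T * (X A T + 2)) (m := 1 / 2) (by linarith) hbd (by nlinarith) (by norm_num)
    (han.mono (hQK.trans hKim)) hQ0 (fun t _ => hre2 t)
    (hanb d (by linarith [hd.1]) hd.2.le) (hanb b hb.1.le (by linarith [hb.2]))
    (hMb d (by linarith [hd.1]) hd.2.le) (hMb b hb.1.le (by linarith [hb.2])) s hmem
  have hcomp : ∑ z ∈ s, analyticOrderNatAt riemannZeta z * (z.re - a) ≤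
      ∑ z ∈ s, analyticOrderNatAt h z * (z.re - a) := by
    refine Finset.sum_le_sum fun z hz => ?_
    obtain ⟨h1, h2, h3, h4⟩ := hs z hz
    have hlt := riemannZeta_zero_re_lt_one h1
    have hz1 : z ≠ 1 := by rintro rfl; simp at hlt
    have hU : AnalyticAt ℂ (U A) z := (differentiable_U A).analyticAt z
    have hζ : AnalyticAt ℂ riemannZeta z := analyticOn_riemannZeta z hz1
    have hord : analyticOrderNatAt riemannZeta z ≤ analyticOrderNatAt h z := by
      refine analyticOrderNatAt_le_of_eventuallyEq_mul
        (k := fun s => U A s * (2 - riemannZeta s * U A s)) (w := (2 : ℂ) + 14 * I)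
        (convex_Icc_reProdIm_Icc (1 / 2) 2 14 T).isPreconnected (han.mono hKim)
        (hQK (hmem z hz).1) (by rw [mem_reProdIm]; norm_num; linarith) (hne2 _ (by simp)) hζ ?_ ?_
      · exact hU.mul (analyticAt_const.sub (hζ.mul hU))
      · exact Eventually.of_forall fun s => one_sub_V_sq A s
    have h5 : (analyticOrderNatAt riemannZeta z : ℝ) ≤ analyticOrderNatAt h z := by
      exact_mod_cast hord
    exact mul_le_mul_of_nonneg_right h5 (by linarith)
  have hcl : ContinuousOn (fun t : ℝ => h (a + t * I)) (Icc b d) := by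
    refine (han.mono (hQK.trans hKim)).continuousOn.comp (by fun_prop) fun t ht => ?_
    rw [mem_reProdIm]
    simp [ht.1, ht.2]
    linarith
  have hcr : ContinuousOn (fun t : ℝ => h ((2 : ℝ) + t * I)) (Icc b d) := by
    refine (han.mono (hQK.trans hKim)).continuousOn.comp (by fun_prop) fun t ht => ?_
    rw [mem_reProdIm]
    simp [ht.1, ht.2]
    linarith
  have hleft : (∫ t in b..d, Real.log ‖h (a + t * I)‖) ≤
      ∫ t in (14 : ℝ)..T, ‖V A (a + I * t)‖ ^ 2 := by
    have hne : ∀ t ∈ Icc b d, h (a + t * I) ≠ 0 := fun t ht h0 => by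
      have hm : (a + t * I : ℂ) ∈ Q := by
        rw [mem_reProdIm]
        simp [ht.1, ht.2]
        linarith
      have := (mem_reProdIm.1 (hQ0 _ hm h0)).1.1
      simp at this
    calc (∫ t in b..d, Real.log ‖h (a + t * I)‖) ≤ ∫ t in b..d, ‖V A (a + I * t)‖ ^ 2 := by
          refine intervalIntegral.integral_mono_on hbd.le
            (intervalIntegrable_log_norm hbd.le hcl hne)
            (intervalIntegrable_V_line A (by linarith [hb.1]) hbd.le a) fun t _ => ?_
          rw [mul_comm I]
          exact log_norm_one_sub_sq_le _
      _ ≤ _ := by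
          refine intervalIntegral.integral_mono_interval hb.1.le hbd.le hd.2.le
            (ae_of_all _ fun t => by positivity)
            (intervalIntegrable_V_line A (by norm_num) (by linarith) a)
  have hright : -(∫ t in b..d, Real.log ‖h ((2 : ℝ) + t * I)‖) ≤ 16 * T / A := by
    have hpt : ∀ t : ℝ, -(1 / (2 * A)) ≤ Real.log ‖h ((2 : ℝ) + t * I)‖ := by
      intro t
      have h1 : 1 - ‖V A ((2 : ℝ) + t * I)‖ ^ 2 ≤ ‖h ((2 : ℝ) + t * I)‖ := by
        have := norm_sub_norm_le 1 (V A ((2 : ℝ) + t * I) ^ 2)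
        rwa [norm_one, norm_pow] at this
      have h2 := hV2 t
      have h3 := hVhalf t
      have hx : 1 / 2 ≤ ‖h ((2 : ℝ) + t * I)‖ := by linarith
      have h4 := Real.one_sub_inv_le_log_of_pos (by linarith : 0 < ‖h ((2 : ℝ) + t * I)‖)
      have h5 : -(2 * ‖V A ((2 : ℝ) + t * I)‖ ^ 2) ≤ 1 - ‖h ((2 : ℝ) + t * I)‖⁻¹ := by
        have h6 : ‖h ((2 : ℝ) + t * I)‖⁻¹ ≤ 1 + 2 * ‖V A ((2 : ℝ) + t * I)‖ ^ 2 := by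
          rw [inv_le_comm₀ (by linarith) (by positivity), inv_le_iff_one_le_mul₀ (by positivity)]
          nlinarith [sq_nonneg (‖V A ((2 : ℝ) + t * I)‖)]
        linarith
      have h7 : (1 / (2 * A) : ℝ) = 2 * (1 / (4 * A)) := by field_simp; norm_num
      linarith
    have h1 : (∫ _ in b..d, (-(1 / (2 * A)) : ℝ)) ≤
        ∫ t in b..d, Real.log ‖h ((2 : ℝ) + t * I)‖ := by
      refine intervalIntegral.integral_mono_on hbd.le intervalIntegrable_const
        (intervalIntegrable_log_norm hbd.le hcr fun t _ => hne2 _ (by simp)) fun t _ => hpt t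
    rw [intervalIntegral.integral_const, smul_eq_mul] at h1
    have h2 : (d - b) * (1 / (2 * A)) ≤ 16 * T / A := by
      have h3 : d - b ≤ 32 * T := by linarith [hd.2, hb.1]
      calc (d - b) * (1 / (2 * A)) ≤ 32 * T * (1 / (2 * A)) := by gcongr
        _ = 16 * T / A := by field_simp; norm_num
    linarith
  have hlog : Real.log (X A T * (X A T + 2)) - Real.log (1 / 2) =
      Real.log (X A T) + Real.log (X A T + 2) + Real.log 2 := by
    rw [Real.log_mul (by linarith) (by linarith), one_div, Real.log_inv]; ring
  rw [hlog] at key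
  have hL : 0 ≤ Real.log (X A T) + Real.log (X A T + 2) + Real.log 2 := by
    have h1 := Real.log_nonneg hX
    have h2 := Real.log_nonneg (by linarith : 1 ≤ X A T + 2)
    have h3 := Real.log_nonneg (by norm_num : (1 : ℝ) ≤ 2)
    linarith
  have h1 : 2 * Real.pi * (2 - a) * (Real.log (X A T) + Real.log (X A T + 2) + Real.log 2) ≤
      2 * Real.pi * (3 / 2) * (Real.log (X A T) + Real.log (X A T + 2) + Real.log 2) := by
    have : 2 - a ≤ 3 / 2 := by linarith
    gcongr
  have h2 : Real.pi * (2 - a) ≤ Real.pi * (3 / 2) := by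
    have : 2 - a ≤ 3 / 2 := by linarith
    gcongr
  have h3 := mul_le_mul_of_nonneg_left hcomp Real.two_pi_pos.le
  linarith

/-- The preceding bound with all weights replaced by `σ - σ₀`, valid on every line `Re s = σ₀` by
continuity in the left edge. -/
theorem mul_sum_order_high_zeros_le {A : ℕ} (hA : 16 ≤ A) {T σ₀ σ : ℝ} (hT : 15 < T)
    (hσ₀ : 1 / 2 ≤ σ₀) (hσ : σ₀ < σ) (hσ1 : σ < 1) (s : Finset ℂ)
    (hs : ∀ z ∈ s, riemannZeta z = 0 ∧ σ ≤ z.re ∧ 15 ≤ z.im ∧ z.im < T) :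
    2 * Real.pi * ((σ - σ₀) * ∑ z ∈ s, (analyticOrderNatAt riemannZeta z : ℝ)) ≤
      (∫ t in (14 : ℝ)..T, ‖V A (σ₀ + I * t)‖ ^ 2) + 16 * T / A +
        2 * Real.pi * (3 / 2) * (Real.log (X A T) + Real.log (X A T + 2) + Real.log 2) +
        Real.pi * (3 / 2) := by
  obtain ⟨F, hF, hle⟩ := exists_finite_sum_order_high_zeros_le hA hT
  set N : ℝ := ∑ z ∈ s, (analyticOrderNatAt riemannZeta z : ℝ) with hN
  set C : ℝ := 2 * Real.pi * (3 / 2) *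
    (Real.log (X A T) + Real.log (X A T + 2) + Real.log 2) + Real.pi * (3 / 2) with hC
  have hev : ∀ᶠ a : ℝ in 𝓝[>] σ₀, 2 * Real.pi * ((σ - a) * N) ≤
      (∫ t in (14 : ℝ)..T, ‖V A (a + I * t)‖ ^ 2) + 16 * T / A + C := by
    have h1 : ∀ᶠ a in 𝓝[>] σ₀, a ∉ F := by
      have : (F \ {σ₀})ᶜ ∈ 𝓝 σ₀ :=
        (hF.subset sdiff_subset).isClosed.isOpen_compl.mem_nhds (by simp)
      filter_upwards [nhdsWithin_le_nhds this, self_mem_nhdsWithin] with a ha ha0 haF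
      exact ha ⟨haF, by simpa using (ne_of_gt ha0)⟩
    filter_upwards [h1, Ioo_mem_nhdsGT hσ] with a haF ha
    have h2 := hle a haF (by linarith [ha.1]) (by linarith [ha.2]) s fun z hz => by
      obtain ⟨h1, h2, h3, h4⟩ := hs z hz
      exact ⟨h1, by linarith [ha.2], h3, h4⟩
    have h3 : (σ - a) * N ≤ ∑ z ∈ s, analyticOrderNatAt riemannZeta z * (z.re - a) := by
      rw [hN, Finset.mul_sum]
      refine Finset.sum_le_sum fun z hz => ?_
      rw [mul_comm]
      have := (hs z hz).2.1
      gcongr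
    have h4 := mul_le_mul_of_nonneg_left h3 Real.two_pi_pos.le
    linarith
  have hlim1 : Tendsto (fun a : ℝ => 2 * Real.pi * ((σ - a) * N)) (𝓝[>] σ₀)
      (𝓝 (2 * Real.pi * ((σ - σ₀) * N))) := by
    have : Continuous fun a : ℝ => 2 * Real.pi * ((σ - a) * N) := by fun_prop
    exact this.continuousAt.tendsto.mono_left nhdsWithin_le_nhds
  have hlim2 : Tendsto (fun a : ℝ => (∫ t in (14 : ℝ)..T, ‖V A (a + I * t)‖ ^ 2) + 16 * T / A + C)
      (𝓝[>] σ₀) (𝓝 ((∫ t in (14 : ℝ)..T, ‖V A (σ₀ + I * t)‖ ^ 2) + 16 * T / A + C)) := by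
    have := continuous_integral_V_line A (p := 14) (q := T) (by norm_num) (by linarith)
    exact (((this.add continuous_const).add continuous_const).continuousAt.tendsto).mono_left
      nhdsWithin_le_nhds
  have := le_of_tendsto_of_tendsto hlim1 hlim2 hev
  rw [hC] at this
  linarith

lemma finite_zetaZeros (σ T : ℝ) : (zetaZeros σ T).Finite := by
  have hK : IsCompact (Icc σ 1 ×ℂ Icc 0 T) := isCompact_Icc.reProdIm isCompact_Icc
  refine hK.inter_riemannZetaZeros_finite.subset fun z hz => ?_
  obtain ⟨h1, h2, h3, h4⟩ := hz
  exact ⟨mem_reProdIm.2 ⟨⟨h2, (riemannZeta_zero_re_lt_one h1).le⟩, h3, h4.le⟩, h1⟩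

end ZeroCounting

/-! ### The logarithmic term and the zero count -/

namespace ZeroCounting

lemma log_seven_sixths_gt : (0.154149 : ℝ) < Real.log (7 / 6) := by
  have h := Real.sum_range_le_log_div (x := 1 / 13) (by norm_num) (by norm_num) 2
  norm_num [Finset.sum_range_succ] at h
  linarith

lemma log_seven_sixths_le : Real.log (7 / 6) ≤ 1 / 6 := by
  have := Real.log_le_sub_one_of_pos (by norm_num : (0 : ℝ) < 7 / 6)
  linarith

/-- Since `T` is doubly exponentially large, `X_A(T) + 2 ≤ 100 T^(9/4)` is precise enough: the
excess of `29.193` over `4.5 / log (7/6)` multiplied by `log T` absorbs all constants. -/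
theorem c_le {A : ℕ} {T : ℝ} (hA : 1 ≤ A) (hAT : (A : ℝ) ≤ 595 / 594 * T)
    (hT : Real.exp (Real.exp 18) ≤ T) : c A T ≤ 29.193 * Real.log T + 11.978 := by
  have hT0 : 0 < T := (Real.exp_pos _).trans_le hT
  have hlogT : Real.exp 18 ≤ Real.log T := (Real.le_log_iff_exp_le hT0).2 hT
  have he18 : (2.7 : ℝ) ^ 18 ≤ Real.exp 18 := by
    have h2 : Real.exp 18 = Real.exp 1 ^ 18 := by rw [← Real.exp_nat_mul]; norm_num
    have := Real.exp_one_gt_d9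
    rw [h2]
    gcongr
    linarith
  have hbig : (10 ^ 7 : ℝ) ≤ Real.log T := by norm_num at he18; linarith
  have hT4 : 4 ≤ T := by
    have h1 := Real.log_le_sub_one_of_pos hT0
    linarith
  have hA1 : (1 : ℝ) ≤ A := by exact_mod_cast hA
  have hXpos : 0 < X A T := by
    have hb : 0 < b₁ := by unfold b₁; norm_num
    have hA0 : (0 : ℝ) < A := by linarith
    rw [X]
    positivity
  have hXle : X A T + 2 ≤ 100 * T ^ (9 / 4 : ℝ) := by
    have e1 : (A : ℝ) ^ (3 / 4 : ℝ) ≤ 2 * T ^ (3 / 4 : ℝ) := by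
      calc (A : ℝ) ^ (3 / 4 : ℝ) ≤ (2 * T) ^ (3 / 4 : ℝ) := by gcongr; linarith
        _ = 2 ^ (3 / 4 : ℝ) * T ^ (3 / 4 : ℝ) := Real.mul_rpow (by norm_num) hT0.le
        _ ≤ 2 ^ (1 : ℝ) * T ^ (3 / 4 : ℝ) := by gcongr <;> norm_num
        _ = _ := by rw [Real.rpow_one]
    have e2 : (T + 7 / 4) ^ (3 / 2 : ℝ) ≤ 4 * T ^ (3 / 2 : ℝ) := by
      calc (T + 7 / 4) ^ (3 / 2 : ℝ) ≤ (2 * T) ^ (3 / 2 : ℝ) := by gcongr; linarith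
        _ = 2 ^ (3 / 2 : ℝ) * T ^ (3 / 2 : ℝ) := Real.mul_rpow (by norm_num) hT0.le
        _ ≤ 2 ^ (2 : ℝ) * T ^ (3 / 2 : ℝ) := by gcongr <;> norm_num
        _ = _ := by norm_num
    have e3 : (T + 7 / 4) ^ (1 / 2 : ℝ) ≤ 4 * T ^ (3 / 2 : ℝ) := by
      refine le_trans ?_ e2
      exact Real.rpow_le_rpow_of_exponent_le (by linarith) (by norm_num)
    have e4 : T ^ (9 / 4 : ℝ) = T ^ (3 / 4 : ℝ) * T ^ (3 / 2 : ℝ) := by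
      rw [← Real.rpow_add hT0]; norm_num
    have e5 : 1 ≤ T ^ (9 / 4 : ℝ) := Real.one_le_rpow (by linarith) (by norm_num)
    have hb : b₁ ≤ 6 := by unfold b₁; norm_num
    have hb0 : 0 ≤ b₁ := by unfold b₁; norm_num
    have e6 : 16 / 9 * (A : ℝ) ^ (3 / 4 : ℝ) * (T + 7 / 4) ^ (3 / 2 : ℝ) ≤
        16 / 9 * (2 * T ^ (3 / 4 : ℝ)) * (4 * T ^ (3 / 2 : ℝ)) := by gcongr
    have e7 : b₁ * (A : ℝ) ^ (3 / 4 : ℝ) * (T + 7 / 4) ^ (1 / 2 : ℝ) ≤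
        6 * (2 * T ^ (3 / 4 : ℝ)) * (4 * T ^ (3 / 2 : ℝ)) := by gcongr
    rw [X]
    rw [e4] at e5 ⊢
    linarith
  have hlog100 : Real.log 100 ≤ 99 := by
    have := Real.log_le_sub_one_of_pos (by norm_num : (0 : ℝ) < 100)
    linarith
  have hlog2 : Real.log 2 ≤ 1 := by
    have := Real.log_le_sub_one_of_pos (by norm_num : (0 : ℝ) < 2)
    linarith
  have hl2 : Real.log (X A T + 2) ≤ 99 + 9 / 4 * Real.log T := by
    refine (Real.log_le_log (by linarith) hXle).trans ?_
    rw [Real.log_mul (by norm_num) (by positivity), Real.log_rpow hT0]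
    linarith
  have hl1 : Real.log (X A T) ≤ 99 + 9 / 4 * Real.log T :=
    (Real.log_le_log hXpos (by linarith)).trans hl2
  have hlog := log_seven_sixths_gt
  have hlpos : 0 < Real.log (7 / 6) := by linarith
  rw [c, ← add_div, ← add_div, div_le_iff₀ hlpos]
  have h1 : (29.193 * Real.log T + 11.978) * 0.154149 ≤
      (29.193 * Real.log T + 11.978) * Real.log (7 / 6) := by
    gcongr
  linarith

/-- The zeros of ordinate at least `15` are counted by the mean square of `V_A`; the constant cost
of the zeros of small ordinate is absorbed by the factor `1 / log (7/6) > 6` in `c_A(T)`. -/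
theorem zeroCount_le {A : ℕ} {σ₀ σ T : ℝ} (hA : 16 ≤ A) (hσ₀ : 1 / 2 ≤ σ₀) (hσ : σ₀ < σ)
    (hσ1 : σ < 1) (hT : 14 ≤ T) :
    (zeroCount σ T : ℝ) ≤ 1 / (σ - σ₀) *
      (1 / (2 * Real.pi) *
        (∫ t in (14 : ℝ)..T, ‖V A ((σ₀ : ℂ) + Complex.I * (t : ℂ))‖ ^ 2) +
        16 * T / (2 * Real.pi * (A : ℝ)) + 1 + c A T) := by
  have hfin : (zetaZeros σ T).Finite := finite_zetaZeros _ _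
  have hA0 : (0 : ℝ) < A := by exact_mod_cast (by omega : 0 < A)
  have hpi := Real.pi_pos
  set J : ℝ := ∫ t in (14 : ℝ)..T, ‖V A ((σ₀ : ℂ) + Complex.I * (t : ℂ))‖ ^ 2 with hJ
  have hJ0 : 0 ≤ J := intervalIntegral.integral_nonneg hT fun t _ => by positivity
  set L : ℝ := Real.log (X A T) + Real.log (X A T + 2) + Real.log 2 with hL
  have hL6 : 6 ≤ L := by
    have hX := exp_three_le_X hA hT
    have h1 : 3 ≤ Real.log (X A T) := (Real.le_log_iff_exp_le (by linarith [Real.exp_pos 3])).2 hX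
    have h2 : 3 ≤ Real.log (X A T + 2) :=
      (Real.le_log_iff_exp_le (by linarith [Real.exp_pos 3])).2 (by linarith)
    have h3 := Real.log_nonneg (by norm_num : (1 : ℝ) ≤ 2)
    linarith
  have hc : 6 * L ≤ c A T := by
    have hlpos : 0 < Real.log (7 / 6) := Real.log_pos (by norm_num)
    rw [c, ← add_div, ← add_div, le_div_iff₀ hlpos]
    nlinarith [log_seven_sixths_le]
  set S := hfin.toFinset with hS
  have hmem : ∀ z ∈ S, riemannZeta z = 0 ∧ σ ≤ z.re ∧ 0 ≤ z.im ∧ z.im < T := fun z hz =>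
    hfin.mem_toFinset.1 hz
  have hcount : (zeroCount σ T : ℝ) =
      (∑ z ∈ S.filter (fun z => z.im < 15), (analyticOrderNatAt riemannZeta z : ℝ)) +
      ∑ z ∈ S.filter (fun z => ¬ z.im < 15), (analyticOrderNatAt riemannZeta z : ℝ) := by
    rw [Finset.sum_filter_add_sum_filter_not, zeroCount,
      finsum_mem_eq_finite_toFinset_sum _ hfin]
    push_cast
    rfl
  have hlow : (σ - σ₀) * (∑ z ∈ S.filter (fun z => z.im < 15),
      (analyticOrderNatAt riemannZeta z : ℝ)) ≤ 27 := by
    refine le_trans ?_ (sum_order_low_zeros_le (S.filter (fun z => z.im < 15)) fun z hz => ?_)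
    · rw [Finset.mul_sum]
      refine Finset.sum_le_sum fun z hz => ?_
      rw [mul_comm]
      have := (hmem z (Finset.mem_filter.1 hz).1).2.1
      gcongr
    · obtain ⟨hz1, hz2⟩ := Finset.mem_filter.1 hz
      obtain ⟨h1, h2, h3, h4⟩ := hmem z hz1
      exact ⟨h1, by linarith, h3, hz2.le⟩
  have hhigh : (σ - σ₀) * (∑ z ∈ S.filter (fun z => ¬ z.im < 15),
      (analyticOrderNatAt riemannZeta z : ℝ)) ≤
      1 / (2 * Real.pi) * J + 16 * T / (2 * Real.pi * A) + 3 / 2 * L + 3 / 4 := by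
    rcases le_or_gt T 15 with hT15 | hT15
    · have : S.filter (fun z => ¬ z.im < 15) = ∅ := by
        refine Finset.filter_eq_empty_iff.2 fun z hz => ?_
        have := (hmem z hz).2.2.2
        simp only [not_not]
        linarith
      rw [this, Finset.sum_empty, mul_zero]
      positivity
    · have h1 := mul_sum_order_high_zeros_le hA hT15 hσ₀ hσ hσ1 (S.filter fun z => ¬ z.im < 15)
        fun z hz => by
          obtain ⟨hz1, hz2⟩ := Finset.mem_filter.1 hz
          obtain ⟨h1, h2, h3, h4⟩ := hmem z hz1
          exact ⟨h1, h2, not_lt.1 hz2, h4⟩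
      rw [← hJ, ← hL] at h1
      refine le_of_mul_le_mul_left (h1.trans (le_of_eq ?_)) Real.two_pi_pos
      field_simp
      ring
  have hsub : 0 < σ - σ₀ := sub_pos.2 hσ
  rw [one_div_mul_eq_div, le_div_iff₀ hsub, mul_comm, hcount, mul_add]
  linarith

end ZeroCounting

theorem lemma4p1 :
    (∀ (A : ℕ) (σ₀ σ T : ℝ), 16 ≤ A → 1 / 2 ≤ σ₀ → σ₀ < σ → σ < 1 → 14 ≤ T →
      (ZeroCounting.zetaZeros σ T).Finite ∧
      (ZeroCounting.zeroCount σ T : ℝ) ≤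
        1 / (σ - σ₀) *
          (1 / (2 * Real.pi) *
              (∫ t in (14 : ℝ)..T, ‖ZeroCounting.V A ((σ₀ : ℂ) + Complex.I * (t : ℂ))‖ ^ 2) +
            16 * T / (2 * Real.pi * (A : ℝ)) + 1 + ZeroCounting.c A T)) ∧
    (∀ (A : ℕ) (T : ℝ), 1 ≤ A → (A : ℝ) ≤ 595 / 594 * T → Real.exp (Real.exp 18) ≤ T →
      ZeroCounting.c A T ≤ 29.193 * Real.log T + 11.978) :=
  ⟨fun _ _ _ _ hA hσ₀ hσ hσ1 hT =>
    ⟨ZeroCounting.finite_zetaZeros _ _, ZeroCounting.zeroCount_le hA hσ₀ hσ hσ1 hT⟩,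
    fun _ _ hA hAT hT => ZeroCounting.c_le hA hAT hT⟩
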